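/- **Uniqueness of near-field phase contrast imaging.** Let $m\ge 1$ be an integer and let $k,d>0$ (wavenumber and propagation distance). On Schwartz functions on $\mathbb R^m$ define the Fresnel propagator $$\mathcal D_d(\Psi)(x)= e^{i(kd-m\pi/4)}\Big(\frac{k}{2\pi d}\Big)^{m/2} e^{\frac{ik|x|^2}{2d}}\int_{\mathbb R^m}\Psi(x')\,e^{\frac{ik|x'|^2}{2d}}\,e^{-\frac{ik\,x\cdot x'}{d}}\,dx',$$ and extend it to tempered distributions by duality (its kernel is symmetric). Let the probe $P:\mathbb R^m\to\mathbb C$ be known and of one of the following two forms: * *plane wave*: $P\equiv p_0$ with $p_0\in\mathbb C\setminus\{0\}$; * *Gaussian beam*: $P$ is a smooth function of temperate growth whose propagated field is $$\mathcal D_d(P)(x)=p_0\,e^{ikd}\exp\!\Big(\alpha_0\,\frac kd\,|x|^2\Big),\qquad p_0\in\mathbb C\setminus\{0\},\quad \operatorname{Re}\alpha_0<0,\quad \operatorname{Im}\alpha_0\neq\tfrac12$$ (in particular every such beam with $\operatorname{Im}\alpha_0\le 0$ is allowed). Call a tempered distribution $O$ on $\mathbb R^m$ an object transmission function if $O\in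 1+\mathscr S'_c(\mathbb R^m)$, i.e. if $O-1$ has compact support. Then for every such $O$ the distributions $\mathcal D_d(P\cdot O)$ and $\mathcal D_d(P\cdot(O-1))$ are given by smooth functions, so that $$I_d:=|\mathcal D_d(P\cdot O)|^2,\qquad I_{d,\mathrm{lin}}:=I_d-|\mathcal D_d(P\cdot(O-1))|^2$$ are well-defined functions on $\mathbb R^m$. Moreover, for every nonempty open set $U\subset\mathbb R^m$, the object $O$ is uniquely determined by the restriction of $I_d$ to $U$, and it is also uniquely determined by the restriction of $I_{d,\mathrm{lin}}$ to $U$: if two object transmission functions $O,\tilde O$ have the same intensity $I_d$ on $U$, or the same linearized intensity $I_{d,\mathrm{lin}}$ on $U$, then $O=\tilde O$. -/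

import Mathlib

open scoped SchwartzMap FourierTransform ContDiff

noncomputable section

namespace PhaseContrast

open MeasureTheory

/-- The lateral space `ℝᵐ`. -/
abbrev Lat (m : ℕ) : Type := EuclideanSpace ℝ (Fin m)

/-! ### The Fresnel propagator -/

/-- The quadratic phase factor `exp (i k |x|² / (2 d))`. -/
def chirp {m : ℕ} (k d : ℝ) (x : Lat m) : ℂ :=
  Complex.exp (Complex.I * ((k * ‖x‖ ^ 2 / (2 * d) : ℝ) : ℂ))

/-- The quadratic phase factor has temperate growth, so that multiplication by it is the true
multiplication on Schwartz functions and on tempered distributions. -/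
theorem chirp_hasTemperateGrowth {m : ℕ} (k d : ℝ) :
    (chirp k d : Lat m → ℂ).HasTemperateGrowth := by
  have hi : ∀ n : ℕ, iteratedDeriv n (fun t : ℝ => Complex.exp (Complex.I * (t : ℂ))) =
      fun t : ℝ => Complex.I ^ n * Complex.exp (Complex.I * (t : ℂ)) := by
    intro n
    induction n with
    | zero => simp
    | succ n ih =>
      rw [iteratedDeriv_succ, ih]
      funext t
      have h := (((hasDerivAt_id (t : ℂ)).const_mul Complex.I).cexp.comp_ofReal).const_mul
        (Complex.I ^ n)
      simp only [id_eq, mul_one] at h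
      rw [h.deriv]
      ring
  have h1 : (fun t : ℝ => Complex.exp (Complex.I * (t : ℂ))).HasTemperateGrowth := by
    refine ⟨(contDiff_const.mul Complex.ofRealCLM.contDiff).cexp, fun n => ⟨0, 1, fun t => ?_⟩⟩
    rw [norm_iteratedFDeriv_eq_norm_iteratedDeriv, hi]
    simp [mul_comm Complex.I, Complex.norm_exp_ofReal_mul_I]
  have h2 : (fun x : Lat m => k / (2 * d) * ‖x‖ ^ 2).HasTemperateGrowth := by
    have := Function.hasTemperateGrowth_norm_sq (H := Lat m)
    fun_prop
  convert h1.comp h2 using 1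
  funext x
  simp only [chirp, Function.comp_apply]
  congr 3
  ring

/-- The constant `exp (i (k d - m π / 4)) (k / (2 π d)) ^ (m / 2)`. -/
def fresnelConst (m : ℕ) (k d : ℝ) : ℂ :=
  Complex.exp (Complex.I * ((k * d - m * Real.pi / 4 : ℝ) : ℂ)) *
    (((k / (2 * Real.pi * d)) ^ ((m : ℝ) / 2) : ℝ) : ℂ)

/-- The dilation `x ↦ (k / (2 π d)) x`, which turns the Fourier kernel `exp (-2 π i ⟪x', ξ⟫)`
into `exp (- i k ⟪x', x⟫ / d)`. -/
def dilation (m : ℕ) {k d : ℝ} (hk : 0 < k) (hd : 0 < d) : Lat m ≃L[ℝ] Lat m :=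
  ContinuousLinearEquiv.smulLeft
    (Units.mk0 (k / (2 * Real.pi * d)) (by positivity))

/-- The Fresnel propagator on Schwartz functions. -/
def fresnelSchwartz (m : ℕ) {k d : ℝ} (hk : 0 < k) (hd : 0 < d) :
    𝓢(Lat m, ℂ) →L[ℂ] 𝓢(Lat m, ℂ) :=
  fresnelConst m k d •
    (SchwartzMap.smulLeftCLM ℂ (chirp k d) ∘L
      SchwartzMap.compCLMOfContinuousLinearEquiv ℂ (dilation m hk hd) ∘L
      SchwartzMap.fourierTransformCLM ℂ ∘L
      SchwartzMap.smulLeftCLM ℂ (chirp k d))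

/-- On Schwartz functions the propagator is the Fresnel integral. -/
theorem fresnelSchwartz_apply (m : ℕ) {k d : ℝ} (hk : 0 < k) (hd : 0 < d)
    (φ : 𝓢(Lat m, ℂ)) (x : Lat m) :
    fresnelSchwartz m hk hd φ x =
      Complex.exp (Complex.I * ((k * d - m * Real.pi / 4 : ℝ) : ℂ)) *
        (((k / (2 * Real.pi * d)) ^ ((m : ℝ) / 2) : ℝ) : ℂ) *
        Complex.exp (Complex.I * ((k * ‖x‖ ^ 2 / (2 * d) : ℝ) : ℂ)) *
        ∫ y : Lat m, φ y * Complex.exp (Complex.I * ((k * ‖y‖ ^ 2 / (2 * d) : ℝ) : ℂ)) *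
          Complex.exp (-(Complex.I * ((k * inner ℝ x y / d : ℝ) : ℂ))) := by
  have hc := chirp_hasTemperateGrowth (m := m) k d
  have hpi := Real.pi_pos
  simp only [fresnelSchwartz, _root_.smul_apply, ContinuousLinearMap.comp_apply,
    SchwartzMap.smulLeftCLM_apply_apply hc,
    SchwartzMap.compCLMOfContinuousLinearEquiv_apply, Function.comp_apply,
    SchwartzMap.fourierTransformCLM_apply, SchwartzMap.fourier_coe, smul_eq_mul, fresnelConst]
  rw [Real.fourier_eq', mul_assoc (_ * _)]
  congr 2
  refine integral_congr_ae (Filter.Eventually.of_forall fun y => ?_)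
  have h : inner ℝ y (dilation m hk hd x) = k / (2 * Real.pi * d) * inner ℝ x y := by
    rw [real_inner_comm]
    exact real_inner_smul_left _ _ _
  simp only [SchwartzMap.smulLeftCLM_apply_apply hc, smul_eq_mul, h, chirp]
  rw [mul_comm, mul_comm (φ y)]
  congr 2
  push_cast
  field_simp

/-- The Fresnel propagator on tempered distributions, defined by duality: the Fresnel kernel is
symmetric, so the propagator is its own transpose. -/
def fresnel (m : ℕ) {k d : ℝ} (hk : 0 < k) (hd : 0 < d) :
    𝓢'(Lat m, ℂ) →L[ℂ] 𝓢'(Lat m, ℂ) :=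
  PointwiseConvergenceCLM.precomp ℂ (fresnelSchwartz m hk hd)

/-- The propagator on tempered distributions extends the one on Schwartz functions. -/
theorem fresnel_coe (m : ℕ) {k d : ℝ} (hk : 0 < k) (hd : 0 < d) (φ : 𝓢(Lat m, ℂ)) :
    fresnel m hk hd (φ : 𝓢'(Lat m, ℂ)) = ((fresnelSchwartz m hk hd φ : 𝓢(Lat m, ℂ)) :
      𝓢'(Lat m, ℂ)) := by
  have hc := chirp_hasTemperateGrowth (m := m) k d
  set s : ℝ := k / (2 * Real.pi * d) with hs
  let L : Lat m →ₗ[ℝ] Lat m →ₗ[ℝ] ℝ := s • innerₗ (Lat m)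
  have hL : ∀ x y, L x y = s * inner ℝ x y := fun x y => rfl
  have hflip : L.flip = L := by
    ext x y
    simp only [LinearMap.flip_apply, hL, real_inner_comm]
  have hF : ∀ (f : 𝓢(Lat m, ℂ)) (x : Lat m), fresnelSchwartz m hk hd f x =
      fresnelConst m k d * (chirp k d x * VectorFourier.fourierIntegral 𝐞 volume L
        (SchwartzMap.smulLeftCLM ℂ (chirp k d) f) x) := by
    intro f x
    simp only [fresnelSchwartz, _root_.smul_apply, ContinuousLinearMap.comp_apply,
      SchwartzMap.smulLeftCLM_apply_apply hc, SchwartzMap.fourier_coe,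
      SchwartzMap.compCLMOfContinuousLinearEquiv_apply, Function.comp_apply,
      SchwartzMap.fourierTransformCLM_apply, smul_eq_mul]
    congr 2
    rw [Real.fourier_eq, VectorFourier.fourierIntegral]
    refine integral_congr_ae (Filter.Eventually.of_forall fun y => ?_)
    have h : inner ℝ y (dilation m hk hd x) = L y x := real_inner_smul_right _ _ _
    simp only [h]
  have hcont : Continuous fun p : Lat m × Lat m => L p.1 p.2 := by
    simp only [hL]
    fun_prop
  ext ψ
  change (φ : 𝓢'(Lat m, ℂ)) (fresnelSchwartz m hk hd ψ) = _
  rw [SchwartzMap.coe_apply, SchwartzMap.coe_apply]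
  have key := VectorFourier.integral_fourierIntegral_smul_eq_flip (L := L)
    (μ := (volume : Measure (Lat m))) (ν := (volume : Measure (Lat m)))
    Real.continuous_fourierChar hcont
    (SchwartzMap.smulLeftCLM ℂ (chirp k d) ψ).integrable
    (SchwartzMap.smulLeftCLM ℂ (chirp k d) φ).integrable
  rw [hflip] at key
  have key' := congrArg (fun z => fresnelConst m k d * z) key
  simp only [← integral_const_mul] at key'
  convert key' using 1
  · refine integral_congr_ae (Filter.Eventually.of_forall fun y => ?_)
    simp only [hF, smul_eq_mul, SchwartzMap.smulLeftCLM_apply_apply hc φ]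
    ring
  · refine integral_congr_ae (Filter.Eventually.of_forall fun y => ?_)
    simp only [hF, smul_eq_mul, SchwartzMap.smulLeftCLM_apply_apply hc ψ]
    ring

/-! ### Distributions given by functions, objects and probes -/

/-- The constant function `1` as a tempered distribution. -/
def oneDist (m : ℕ) : 𝓢'(Lat m, ℂ) := (volume : Measure (Lat m)).toTemperedDistribution

/-- `O ∈ 1 + 𝓢'_c`: the distribution `O - 1` has compact support. -/
def IsObject {m : ℕ} (O : 𝓢'(Lat m, ℂ)) : Prop :=
  IsCompact (Distribution.dsupport (O - oneDist m))

/-- The distribution `T` is given by integration against the smooth function `f`. -/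
def IsGivenBy {m : ℕ} (T : 𝓢'(Lat m, ℂ)) (f : Lat m → ℂ) : Prop :=
  ContDiff ℝ ∞ f ∧ ∀ φ : 𝓢(Lat m, ℂ), HasCompactSupport φ → T φ = ∫ x, φ x * f x

open Classical in
/-- The smooth function by which the distribution `T` is given (unique if it exists, with value
zero if there is none). -/
def toFunction {m : ℕ} (T : 𝓢'(Lat m, ℂ)) : Lat m → ℂ :=
  if h : ∃ f, IsGivenBy T f then h.choose else 0

/-- The propagated field `D_d (P · T)`, where `P` has temperate growth. -/
def propagated {m : ℕ} {k d : ℝ} (hk : 0 < k) (hd : 0 < d) (P : Lat m → ℂ)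
    (T : 𝓢'(Lat m, ℂ)) : 𝓢'(Lat m, ℂ) :=
  fresnel m hk hd (TemperedDistribution.smulLeftCLM ℂ P T)

/-- Plane wave probe: a nonzero constant. -/
def IsPlaneWave {m : ℕ} (P : Lat m → ℂ) : Prop :=
  ∃ p₀ : ℂ, p₀ ≠ 0 ∧ P = fun _ => p₀

/-- Gaussian beam probe: the probe `P` whose propagated field in the detector plane is
`p₀ exp (i k d) exp (α₀ |ξ|²)` in the dimensionless coordinates `ξ = (k / d) ^ (1 / 2) x`, with
`p₀ ≠ 0`, `Re α₀ < 0` and `Im α₀ ≠ 1 / 2`. The last condition holds in particular if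
`Im α₀ ≤ 0`; it says that `α₀ - i / 2` is not real. -/
def IsGaussianBeam {m : ℕ} {k d : ℝ} (hk : 0 < k) (hd : 0 < d) (P : Lat m → ℂ) : Prop :=
  P.HasTemperateGrowth ∧ ∃ p₀ α₀ : ℂ, p₀ ≠ 0 ∧ α₀.re < 0 ∧ α₀.im ≠ 1 / 2 ∧
    IsGivenBy (propagated hk hd P (oneDist m)) fun x =>
      p₀ * Complex.exp (Complex.I * ((k * d : ℝ) : ℂ)) *
        Complex.exp (α₀ * ((k / d * ‖x‖ ^ 2 : ℝ) : ℂ))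

/-! ### Intensities -/

/-- The intensity `I_d = |D_d (P · O)|²`. -/
def intensity {m : ℕ} {k d : ℝ} (hk : 0 < k) (hd : 0 < d) (P : Lat m → ℂ)
    (O : 𝓢'(Lat m, ℂ)) (x : Lat m) : ℝ :=
  ‖toFunction (propagated hk hd P O) x‖ ^ 2

/-- The linearized intensity `I_d - |D_d (P · (O - 1))|²`. -/
def linIntensity {m : ℕ} {k d : ℝ} (hk : 0 < k) (hd : 0 < d) (P : Lat m → ℂ)
    (O : 𝓢'(Lat m, ℂ)) (x : Lat m) : ℝ :=
  intensity hk hd P O x - ‖toFunction (propagated hk hd P (O - oneDist m)) x‖ ^ 2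

end PhaseContrast

end

/-!
Both intensities are squared moduli (up to a subtracted square) of a sum `w + u` of a background
wave `w = D_d(P)` and a scattered wave `u = D_d(P · (O - 1))`.

The background is a Gaussian, `w = g₀ exp (α q)` with `q(x) = (k / d) |x|²`, where `α = 0` for a
plane wave (`integral_fresnelSchwartz`). The scattered wave is `c exp (i q / 2) f`, where `c ≠ 0` is
the constant of the propagator and `f` is the Fourier transform of the compactly supported
distribution `exp (i q / 2) P (O - 1)`, up to a dilation (`exists_propagated_eq`). By a
Paley-Wiener-Schwartz argument (`exists_paleyWiener_fourier`), `f` is smooth and extends along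
every real line to an entire function of exponential type: a compactly supported distribution is a
power of `1 - Δ / (2 π)²` applied to a square-integrable function
(`exists_sq_integrable_representation`, from the finite order of the distribution, Cauchy-Schwarz
and the Riesz representation theorem), and Leibniz' rule reduces the claim to compactly supported
integrable functions.

Take two objects whose intensities agree on `U`, with scattered waves given by `f` and `f'`, and
restrict to a real line through a point of `U`, parametrized by `s`. With `γ = conj α + i / 2`, the
difference of the intensities (`interference_identity`) is
`c₁ exp (γ q) (f - f') + c₂ exp (conj γ q) (f - f')^* + C`, where `^*` is Schwarz reflection, `q` is
a real quadratic polynomial in `s`, and the functions multiplied by exponentials, as well as `C`,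
have exponential type. This is entire and vanishes for small real `s`, hence for all complex `s`.
Since `Im α ≠ 1 / 2`, `γ` is not real, and on a ray in the direction of a square root of `± i` the
three terms have sizes `exp (t r²)`, `exp (- t r²)` and `1`, with `t > 0`, up to factors
`exp (O(r))`. So `f - f'` has Gaussian decay on that ray, and a Phragmén-Lindelöf argument shows
that it vanishes (`IsExpType.eq_zero_of_gaussian_combination`). The
nonlinear term enters only through `C`, so the linearized intensity is no different.

Finally `f = f'` gives `O = O'`, since the propagator is invertible and the probe is smooth without
zeros (`eq_of_propagated_eq`); for a Gaussian beam this holds because the probe, recovered by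
inverting the propagator, is a Gaussian (`IsGaussianBeam.ne_zero`).
-/

noncomputable section

namespace PhaseContrast

open MeasureTheory

/-! ### Cutoffs and compactly supported tempered distributions -/

section Cutoff

open Filter Topology

variable {E : Type*} [NormedAddCommGroup E] [InnerProductSpace ℝ E] [FiniteDimensional ℝ E]

omit [FiniteDimensional ℝ E] in
theorem toSchwartzMap_coe {f : E → ℂ} (h₁ : HasCompactSupport f) (h₂ : ContDiff ℝ ∞ f) :
    ⇑(h₁.toSchwartzMap h₂) = f := rfl

omit [FiniteDimensional ℝ E] in
theorem norm_iteratedFDeriv_comp_smul_le {f : E → ℂ} (hf : ContDiff ℝ ∞ f) (r : ℝ) (n : ℕ)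
    (x : E) : ‖iteratedFDeriv ℝ n (fun y => f (r • y)) x‖ ≤
      |r| ^ n * ‖iteratedFDeriv ℝ n f (r • x)‖ := by
  have h := (r • ContinuousLinearMap.id ℝ E).iteratedFDeriv_comp_right (f := f) hf x
    (i := n) (mod_cast le_top)
  have h' : (f ∘ (r • ContinuousLinearMap.id ℝ E)) = fun y => f (r • y) := by
    ext y; simp
  rw [h'] at h
  rw [h]
  refine (ContinuousMultilinearMap.norm_compContinuousLinearMap_le _ _).trans ?_
  have hr : ‖r • ContinuousLinearMap.id ℝ E‖ ≤ |r| := by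
    refine ContinuousLinearMap.opNorm_le_bound _ (abs_nonneg _) fun y => ?_
    simp [norm_smul]
  rw [mul_comm]
  simp only [Finset.prod_const, Finset.card_univ, Fintype.card_fin, _root_.smul_apply,
    ContinuousLinearMap.id_apply]
  gcongr

/-- A smooth function that equals `1` near a compact set, as a Schwartz function of compact
support. -/
theorem exists_schwartz_one_near {K : Set E} (hK : IsCompact K) :
    ∃ η : 𝓢(E, ℂ), HasCompactSupport η ∧ ∀ᶠ x in 𝓝ˢ K, η x = 1 := by
  obtain ⟨R, hR⟩ := hK.isBounded.subset_closedBall (0 : E)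
  obtain ⟨f, hf1, hf0, -⟩ := exists_contMDiffMap_one_nhds_of_subset_interior
    (n := ⊤) (modelWithCornersSelf ℝ E) hK.isClosed
    (t := Metric.closedBall (0 : E) (R + 1))
    ((hR.trans (Metric.closedBall_subset_ball (by linarith))).trans
      Metric.ball_subset_interior_closedBall)
  have hs : HasCompactSupport (fun x => (f x : ℂ)) := by
    refine HasCompactSupport.intro (isCompact_closedBall (0 : E) (R + 1)) fun x hx => ?_
    simp [hf0 x hx]
  have hd : ContDiff ℝ ∞ (fun x => (f x : ℂ)) :=
    Complex.ofRealCLM.contDiff.comp f.contMDiff.contDiff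
  refine ⟨hs.toSchwartzMap hd, hs, ?_⟩
  filter_upwards [hf1] with x hx
  simp [hx]

/-- Dilated cutoffs approximate the identity on the Schwartz space. -/
theorem exists_cutoff_tendsto :
    ∃ χ : ℕ → 𝓢(E, ℂ), (∀ n, HasCompactSupport (χ n)) ∧
      ∀ φ : 𝓢(E, ℂ), Tendsto (fun n => SchwartzMap.smulLeftCLM ℂ (χ n) φ) atTop (𝓝 φ) := by
  obtain ⟨η, hηc, hη1⟩ := exists_schwartz_one_near (E := E) (isCompact_closedBall (0 : E) 1)
  set g : E → ℂ := fun x => η x - 1 with hg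
  have hgd : ContDiff ℝ ∞ g := (η.smooth ⊤).sub contDiff_const
  -- Every derivative of `η - 1` is bounded and vanishes on the unit ball.
  have hbd : ∀ j : ℕ, ∃ C : ℝ, 0 ≤ C ∧ ∀ x, ‖iteratedFDeriv ℝ j g x‖ ≤ C * ‖x‖ := by
    intro j
    refine ⟨SchwartzMap.seminorm ℝ 0 j η + 1, by positivity, fun x => ?_⟩
    by_cases hx : ‖x‖ ≤ 1
    · have h0 : g =ᶠ[𝓝 x] 0 := by
        have hmem : x ∈ Metric.closedBall (0 : E) 1 := by simpa using hx
        filter_upwards [(eventually_nhdsSet_iff_forall.1 hη1) x hmem] with y hy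
        simp [hg, hy]
      have h1 := (h0.iteratedFDeriv ℝ j).eq_of_nhds
      rw [h1]
      have h2 : iteratedFDeriv ℝ j (0 : E → ℂ) x = 0 := by
        have := iteratedFDeriv_fun_zero (𝕜 := ℝ) (E := E) (F := ℂ) (n := j)
        exact congrFun this x
      rw [h2]
      simpa using by positivity
    · push Not at hx
      have h1 : ‖iteratedFDeriv ℝ j g x‖ ≤ SchwartzMap.seminorm ℝ 0 j η + 1 := by
        have h2 : iteratedFDeriv ℝ j g x =
            iteratedFDeriv ℝ j η x - iteratedFDeriv ℝ j (fun _ : E => (1 : ℂ)) x :=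
          iteratedFDeriv_sub_apply (η.contDiffAt j) contDiffAt_const
        rw [h2]
        refine (norm_sub_le _ _).trans (add_le_add (η.norm_iteratedFDeriv_le_seminorm ℝ j x) ?_)
        cases j with
        | zero => simp
        | succ j => simp [iteratedFDeriv_succ_const]
      refine h1.trans ?_
      exact le_mul_of_one_le_right (by positivity) hx.le
  choose C hC0 hC using hbd
  set r : ℕ → ℝ := fun n => 1 / ((n : ℝ) + 1) with hr
  have hrpos : ∀ n, 0 < r n := fun n => by simp only [hr]; positivity
  have hr1 : ∀ n, r n ≤ 1 := fun n => by
    simp only [hr]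
    rw [div_le_one (by positivity)]
    linarith [(Nat.cast_nonneg n : (0 : ℝ) ≤ n)]
  have hcs : ∀ n, HasCompactSupport fun x => η (r n • x) := fun n =>
    hηc.comp_homeomorph (Homeomorph.smulOfNeZero (r n) (hrpos n).ne')
  have hcd : ∀ n, ContDiff ℝ ∞ fun x => η (r n • x) := fun n =>
    (η.smooth ⊤).comp (contDiff_const_smul (r n))
  refine ⟨fun n => (hcs n).toSchwartzMap (hcd n), fun n => hcs n, fun φ => ?_⟩
  rw [(schwartz_withSeminorms ℂ E ℂ).tendsto_nhds]
  rintro ⟨k, l⟩ ε hε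
  set B : ℝ := ∑ i ∈ Finset.range (l + 1), (l.choose i : ℝ) * C i *
    SchwartzMap.seminorm ℝ (k + 1) (l - i) φ with hB
  have hB0 : 0 ≤ B := Finset.sum_nonneg fun i _ => by
    have := hC0 i
    positivity
  have hlim : Tendsto (fun n => r n * B) atTop (𝓝 0) := by
    simpa [hr] using (tendsto_one_div_add_atTop_nhds_zero_nat (𝕜 := ℝ)).mul_const B
  filter_upwards [hlim.eventually (gt_mem_nhds hε)] with n hn
  refine lt_of_le_of_lt ?_ hn
  refine SchwartzMap.seminorm_le_bound ℂ k l _ (mul_nonneg (hrpos n).le hB0) fun x => ?_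
  have hfun : ⇑(SchwartzMap.smulLeftCLM ℂ ((hcs n).toSchwartzMap (hcd n)) φ - φ) =
      fun y => g (r n • y) * φ y := by
    ext y
    have : (⇑((hcs n).toSchwartzMap (hcd n))).HasTemperateGrowth :=
      SchwartzMap.hasTemperateGrowth _
    simp only [_root_.sub_apply, SchwartzMap.smulLeftCLM_apply_apply this, smul_eq_mul, hg]
    simp only [toSchwartzMap_coe]
    ring
  rw [hfun]
  have hL := norm_iteratedFDeriv_mul_le (𝕜 := ℝ) (f := fun y => g (r n • y)) (g := φ) (N := ∞)
    (hgd.comp (contDiff_const_smul (r n))) (φ.smooth ⊤) x (n := l) (mod_cast le_top)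
  calc ‖x‖ ^ k * ‖iteratedFDeriv ℝ l (fun y => g (r n • y) * φ y) x‖
      ≤ ‖x‖ ^ k * ∑ i ∈ Finset.range (l + 1), (l.choose i : ℝ) *
          ‖iteratedFDeriv ℝ i (fun y => g (r n • y)) x‖ * ‖iteratedFDeriv ℝ (l - i) φ x‖ := by
        gcongr
    _ = ∑ i ∈ Finset.range (l + 1), ‖x‖ ^ k * ((l.choose i : ℝ) *
          ‖iteratedFDeriv ℝ i (fun y => g (r n • y)) x‖ * ‖iteratedFDeriv ℝ (l - i) φ x‖) :=
        Finset.mul_sum _ _ _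
    _ ≤ ∑ i ∈ Finset.range (l + 1), r n * ((l.choose i : ℝ) * C i *
          SchwartzMap.seminorm ℝ (k + 1) (l - i) φ) := by
        refine Finset.sum_le_sum fun i _ => ?_
        have h1 : ‖iteratedFDeriv ℝ i (fun y => g (r n • y)) x‖ ≤ r n * (C i * ‖x‖) := by
          refine (norm_iteratedFDeriv_comp_smul_le hgd (r n) i x).trans ?_
          rw [abs_of_pos (hrpos n)]
          calc r n ^ i * ‖iteratedFDeriv ℝ i g (r n • x)‖
              ≤ 1 * (C i * ‖r n • x‖) := by
                gcongr
                · exact pow_le_one₀ (hrpos n).le (hr1 n)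
                · exact hC i _
            _ = r n * (C i * ‖x‖) := by
                rw [norm_smul, Real.norm_of_nonneg (hrpos n).le]; ring
        calc ‖x‖ ^ k * ((l.choose i : ℝ) * ‖iteratedFDeriv ℝ i (fun y => g (r n • y)) x‖ *
              ‖iteratedFDeriv ℝ (l - i) φ x‖)
            ≤ ‖x‖ ^ k * ((l.choose i : ℝ) * (r n * (C i * ‖x‖)) *
              ‖iteratedFDeriv ℝ (l - i) φ x‖) := by gcongr
          _ = r n * ((l.choose i : ℝ) * C i *
              (‖x‖ ^ (k + 1) * ‖iteratedFDeriv ℝ (l - i) φ x‖)) := by ring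
          _ ≤ _ := by
              have := hC0 i
              have := (hrpos n).le
              gcongr
              exact φ.le_seminorm ℝ (k + 1) (l - i) x
    _ = r n * B := by rw [hB, Finset.mul_sum]

/-- A tempered distribution vanishes on test functions whose compact support avoids its
support. -/
theorem apply_eq_zero_of_disjoint_dsupport {T : 𝓢'(E, ℂ)} {u : 𝓢(E, ℂ)}
    (hu : HasCompactSupport u) (hd : Disjoint (tsupport u) (Distribution.dsupport T)) :
    T u = 0 := by
  have hloc : ∀ x ∈ tsupport u, ∃ s : Set E, Distribution.IsVanishingOn T s ∧ IsOpen s ∧ x ∈ s :=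
    fun x hx => (Distribution.notMem_dsupport_iff x).1 (Set.disjoint_left.1 hd hx)
  choose! V hVT hVo hVx using hloc
  obtain ⟨t, ht, htu⟩ := hu.isCompact.elim_nhds_subcover V
    fun x hx => (hVo x hx).mem_nhds (hVx x hx)
  obtain ⟨ρ, hρ⟩ := SmoothPartitionOfUnity.exists_isSubordinate (modelWithCornersSelf ℝ E)
    (isClosed_tsupport u) (fun i : t => V i) (fun i => hVo _ (ht i i.2))
    (by simpa [Set.iUnion_subtype] using htu)
  have hρd : ∀ i, ContDiff ℝ ∞ fun x => (ρ i x : ℂ) := fun i =>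
    Complex.ofRealCLM.contDiff.comp (ρ i).contMDiff.contDiff
  have hc : ∀ i, HasCompactSupport fun x => (ρ i x : ℂ) * u x := fun i => hu.mul_left
  have hsum : u = ∑ i, (hc i).toSchwartzMap ((hρd i).mul (u.smooth ⊤)) := by
    ext x
    rw [sum_apply]
    simp only [toSchwartzMap_coe]
    rw [← Finset.sum_mul]
    by_cases hx : x ∈ tsupport u
    · have h1 := ρ.sum_eq_one hx
      rw [finsum_eq_sum_of_fintype] at h1
      rw [← Complex.ofReal_sum, h1]
      simp
    · simp [image_eq_zero_of_notMem_tsupport hx]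
  rw [hsum, map_sum]
  refine Finset.sum_eq_zero fun i _ => hVT i (ht i i.2) _ ?_
  refine Set.Subset.trans ?_ (hρ i)
  refine closure_mono fun x hx => ?_
  simp only [toSchwartzMap_coe, Function.mem_support] at hx ⊢
  intro h0
  simp [h0] at hx

/-- A tempered distribution with compact support does not see test functions away from a
neighbourhood of the support. -/
theorem exists_cutoff_apply_eq {T : 𝓢'(E, ℂ)} (hT : IsCompact (Distribution.dsupport T)) :
    ∃ η : 𝓢(E, ℂ), HasCompactSupport η ∧
      ∀ φ : 𝓢(E, ℂ), T (SchwartzMap.smulLeftCLM ℂ η φ) = T φ := by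
  obtain ⟨η, hηc, hη1⟩ := exists_schwartz_one_near hT
  refine ⟨η, hηc, fun φ => ?_⟩
  obtain ⟨χ, hχc, hχ⟩ := exists_cutoff_tendsto (E := E)
  have key : ∀ n, T (SchwartzMap.smulLeftCLM ℂ (χ n) (SchwartzMap.smulLeftCLM ℂ η φ)) =
      T (SchwartzMap.smulLeftCLM ℂ (χ n) φ) := by
    intro n
    rw [← sub_eq_zero, ← map_sub]
    set w := SchwartzMap.smulLeftCLM ℂ (χ n) (SchwartzMap.smulLeftCLM ℂ η φ) -
      SchwartzMap.smulLeftCLM ℂ (χ n) φ with hw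
    have hwx : ∀ x, w x = χ n x * ((η x - 1) * φ x) := by
      intro x
      simp only [hw, _root_.sub_apply,
        SchwartzMap.smulLeftCLM_apply_apply (χ n).hasTemperateGrowth,
        SchwartzMap.smulLeftCLM_apply_apply η.hasTemperateGrowth, smul_eq_mul]
      ring
    have hwf : ⇑w = fun x => χ n x * ((η x - 1) * φ x) := funext hwx
    refine apply_eq_zero_of_disjoint_dsupport ?_ ?_
    · rw [hwf]
      exact (hχc n).mul_right
    · rw [Set.disjoint_left]
      intro x hx hxK
      have h0 : ⇑w =ᶠ[𝓝 x] 0 := by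
        filter_upwards [(eventually_nhdsSet_iff_forall.1 hη1) x hxK] with y hy
        simp [hwx, hy]
      exact (notMem_tsupport_iff_eventuallyEq.2 h0) hx
  have h1 := (T.continuous.tendsto _).comp (hχ (SchwartzMap.smulLeftCLM ℂ η φ))
  have h2 := (T.continuous.tendsto _).comp (hχ φ)
  refine tendsto_nhds_unique h1 (h2.congr fun n => ?_)
  exact (key n).symm

end Cutoff

/-! ### Finite order of compactly supported distributions -/

section Order

variable {E : Type*} [NormedAddCommGroup E] [InnerProductSpace ℝ E] [FiniteDimensional ℝ E]

omit [FiniteDimensional ℝ E] in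
/-- Multiplication by a Schwartz function removes the polynomial weights from the Schwartz
seminorms. -/
theorem seminorm_smulLeftCLM_le (η ψ : 𝓢(E, ℂ)) (k n : ℕ) :
    SchwartzMap.seminorm ℝ k n (SchwartzMap.smulLeftCLM ℂ η ψ) ≤
      ∑ i ∈ Finset.range (n + 1), (n.choose i : ℝ) * SchwartzMap.seminorm ℝ k i η *
        SchwartzMap.seminorm ℝ 0 (n - i) ψ := by
  refine SchwartzMap.seminorm_le_bound ℝ k n _
    (Finset.sum_nonneg fun i _ => by positivity) fun x => ?_
  have hfun : ⇑(SchwartzMap.smulLeftCLM ℂ η ψ) = fun y => η y * ψ y := by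
    ext y
    simp [SchwartzMap.smulLeftCLM_apply_apply η.hasTemperateGrowth]
  rw [hfun]
  have hL := norm_iteratedFDeriv_mul_le (𝕜 := ℝ) (f := η) (g := ψ) (N := ∞)
    (η.smooth ⊤) (ψ.smooth ⊤) x (n := n) (mod_cast le_top)
  refine (mul_le_mul_of_nonneg_left hL (by positivity)).trans ?_
  rw [Finset.mul_sum]
  refine Finset.sum_le_sum fun i _ => ?_
  have h1 := η.le_seminorm ℝ k i x
  have h2 := ψ.norm_iteratedFDeriv_le_seminorm ℝ (n - i) x
  calc ‖x‖ ^ k * ((n.choose i : ℝ) * ‖iteratedFDeriv ℝ i η x‖ * ‖iteratedFDeriv ℝ (n - i) ψ x‖)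
      = (n.choose i : ℝ) * (‖x‖ ^ k * ‖iteratedFDeriv ℝ i η x‖) *
          ‖iteratedFDeriv ℝ (n - i) ψ x‖ := by ring
    _ ≤ _ := by gcongr

omit [FiniteDimensional ℝ E] in
/-- A tempered distribution multiplied by a Schwartz function has finite order. -/
theorem exists_order_bound (T : 𝓢'(E, ℂ)) (η : 𝓢(E, ℂ)) :
    ∃ (C : ℝ) (N : ℕ), 0 ≤ C ∧ ∀ ψ : 𝓢(E, ℂ), ‖T (SchwartzMap.smulLeftCLM ℂ η ψ)‖ ≤
      C * ∑ i ∈ Finset.range (N + 1), SchwartzMap.seminorm ℝ 0 i ψ := by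
  obtain ⟨s, C, -, hC⟩ := Seminorm.bound_of_continuous (schwartz_withSeminorms ℝ E ℂ)
    ((normSeminorm ℝ ℂ).comp ((T : 𝓢(E, ℂ) →ₗ[ℂ] ℂ).restrictScalars ℝ))
    (by exact continuous_norm.comp T.continuous)
  have hT : ∀ ψ : 𝓢(E, ℂ), ‖T ψ‖ ≤ C * ∑ p ∈ s, SchwartzMap.seminorm ℝ p.1 p.2 ψ := by
    intro ψ
    refine (hC ψ).trans ?_
    have h2 := Seminorm.finset_sup_le_sum (schwartzSeminormFamily ℝ E ℂ) s ψ
    rw [_root_.sum_apply] at h2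
    exact mul_le_mul_of_nonneg_left h2 C.2
  set N := s.sup Prod.snd with hN
  set D : ℝ := ∑ p ∈ s, ∑ i ∈ Finset.range (p.2 + 1),
    (p.2.choose i : ℝ) * SchwartzMap.seminorm ℝ p.1 i η with hD
  refine ⟨C * D, N, mul_nonneg C.2 (Finset.sum_nonneg fun p _ => Finset.sum_nonneg fun i _ => by
    positivity), fun ψ => (hT _).trans ?_⟩
  rw [mul_assoc]
  refine mul_le_mul_of_nonneg_left ?_ C.2
  rw [hD, Finset.sum_mul]
  refine Finset.sum_le_sum fun p hp => (seminorm_smulLeftCLM_le η ψ p.1 p.2).trans ?_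
  rw [Finset.sum_mul]
  refine Finset.sum_le_sum fun i _ => ?_
  refine mul_le_mul_of_nonneg_left ?_ (by positivity)
  refine Finset.single_le_sum (f := fun i => SchwartzMap.seminorm ℝ 0 i ψ)
    (fun i _ => by positivity) ?_
  have : p.2 ≤ N := Finset.le_sup (f := Prod.snd) hp
  simp only [Finset.mem_range]
  omega

variable [MeasurableSpace E] [BorelSpace E]

/-- The polynomial weight `(1 + |x|²) ^ M`. -/
def weight (E : Type*) [NormedAddCommGroup E] (M : ℕ) (x : E) : ℝ := (1 + ‖x‖ ^ 2) ^ M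

omit [FiniteDimensional ℝ E] [MeasurableSpace E] [BorelSpace E] in
@[fun_prop]
theorem weight_hasTemperateGrowth (M : ℕ) : (weight E M).HasTemperateGrowth := by
  have := Function.hasTemperateGrowth_norm_sq (H := E)
  unfold weight
  fun_prop

omit [InnerProductSpace ℝ E] [FiniteDimensional ℝ E] [MeasurableSpace E] [BorelSpace E] in
theorem pow_norm_le_weight {i N : ℕ} (h : i ≤ N) (x : E) : ‖x‖ ^ i ≤ weight E N x := by
  have h1 : ‖x‖ ≤ 1 + ‖x‖ ^ 2 := by nlinarith [sq_nonneg (‖x‖ - 1), norm_nonneg x]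
  have h2 : 1 ≤ 1 + ‖x‖ ^ 2 := by nlinarith [sq_nonneg (‖x‖)]
  exact (pow_le_pow_left₀ (norm_nonneg x) h1 i).trans (pow_le_pow_right₀ h2 h)

omit [InnerProductSpace ℝ E] [FiniteDimensional ℝ E] [MeasurableSpace E] [BorelSpace E] in
theorem one_le_weight (N : ℕ) (x : E) : 1 ≤ weight E N x := by
  simpa using pow_norm_le_weight (Nat.zero_le N) x

theorem integrable_weight_mul (f : 𝓢(E, ℂ)) (N : ℕ) :
    Integrable fun x => weight E N x * ‖f x‖ := by
  have := (SchwartzMap.smulLeftCLM ℂ (weight E N) f).integrable (μ := volume)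
  refine this.norm.congr (Filter.Eventually.of_forall fun x => ?_)
  simp only [SchwartzMap.smulLeftCLM_apply_apply (weight_hasTemperateGrowth N), norm_smul]
  rw [Real.norm_of_nonneg (zero_le_one.trans (one_le_weight N x))]

theorem seminorm_fourierInv_le {i N : ℕ} (h : i ≤ N) (f : 𝓢(E, ℂ)) :
    SchwartzMap.seminorm ℝ 0 i (𝓕⁻ f) ≤
      (2 * Real.pi) ^ i * ((i + 1 : ℕ) * ∫ x, weight E N x * ‖f x‖) := by
  have hI : 0 ≤ ∫ x, weight E N x * ‖f x‖ := integral_nonneg fun x =>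
    mul_nonneg (zero_le_one.trans (one_le_weight N x)) (norm_nonneg _)
  refine SchwartzMap.seminorm_le_bound ℝ 0 i _ (by positivity) fun x => ?_
  have hf : ⇑(𝓕⁻ f : 𝓢(E, ℂ)) = fun y => (𝓕 f : 𝓢(E, ℂ)) ((-1 : ℝ) • y) := by
    ext y
    rw [SchwartzMap.fourierInv_apply_eq]
    simp
  rw [pow_zero, one_mul, hf]
  refine (norm_iteratedFDeriv_comp_smul_le ((𝓕 f).smooth ⊤) (-1) i x).trans ?_
  simp only [abs_neg, abs_one, one_pow, one_mul]
  rw [SchwartzMap.fourier_coe]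
  have := Real.pow_mul_norm_iteratedFDeriv_fourier_le (K := ⊤) (N := ⊤) (f.smooth ⊤)
    (fun k n _ _ => f.integrable_pow_mul_iteratedFDeriv (μ := volume) k n) (k := i) (n := 0)
    le_top le_top ((-1 : ℝ) • x)
  simp only [pow_zero, one_mul, mul_one] at this
  refine this.trans ?_
  gcongr
  rw [Finset.sum_product]
  simp only [zero_add, Finset.range_one, Finset.sum_singleton, norm_iteratedFDeriv_zero]
  refine (Finset.sum_le_card_nsmul _ _ (∫ x, weight E N x * ‖f x‖) fun j hj => ?_).trans ?_
  · refine integral_mono (f.integrable_pow_mul volume j) (integrable_weight_mul f N) fun y => ?_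
    exact mul_le_mul_of_nonneg_right
      (pow_norm_le_weight (by simp only [Finset.mem_range] at hj; omega) y) (norm_nonneg _)
  · simp

/-- Cauchy-Schwarz: weighted `L¹` norms are controlled by weighted `L²` norms. -/
theorem exists_integral_weight_le (N : ℕ) : ∃ (C : ℝ) (M : ℕ), 0 ≤ C ∧ ∀ f : 𝓢(E, ℂ),
    ∫ x, weight E N x * ‖f x‖ ≤ C * ‖(SchwartzMap.smulLeftCLM ℂ (weight E M) f).toLp 2‖ := by
  set d := Module.finrank ℝ E + 1 with hd
  set g : E → ℝ := fun x => (weight E d x)⁻¹ with hg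
  have hwpos : ∀ n (x : E), 0 < weight E n x := fun n x => zero_lt_one.trans_le (one_le_weight n x)
  have hgc : Continuous g := by
    have : Continuous (weight E d) := (weight_hasTemperateGrowth (E := E) d).1.continuous
    exact this.inv₀ fun x => (hwpos d x).ne'
  have hg2 : Integrable (fun x => g x ^ 2) := by
    have h1 := integrable_rpow_neg_one_add_norm_sq (E := E) (μ := volume) (r := d)
      (by rw [hd]; push_cast; linarith)
    refine h1.mono' (by fun_prop) (Filter.Eventually.of_forall fun x => ?_)
    have hb : 1 ≤ 1 + ‖x‖ ^ 2 := by nlinarith [sq_nonneg (‖x‖)]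
    rw [Real.norm_of_nonneg (by positivity)]
    simp only [hg, weight]
    rw [← inv_pow, ← pow_mul, inv_pow, ← Real.rpow_natCast, ← Real.rpow_neg (by positivity)]
    refine Real.rpow_le_rpow_of_exponent_le hb ?_
    push_cast
    have : (0 : ℝ) ≤ d := Nat.cast_nonneg d
    linarith
  have hgm : MemLp g 2 := (memLp_two_iff_integrable_sq hgc.aestronglyMeasurable).2 hg2
  refine ⟨(∫ x, g x ^ (2 : ℝ)) ^ (1 / (2 : ℝ)), N + d,
    Real.rpow_nonneg (integral_nonneg fun x =>
      Real.rpow_nonneg (inv_nonneg.2 (hwpos d x).le) _) _, fun f => ?_⟩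
  set F := SchwartzMap.smulLeftCLM ℂ (weight E (N + d)) f with hF
  have hFn : ∀ x, ‖F x‖ = weight E (N + d) x * ‖f x‖ := fun x => by
    rw [hF, SchwartzMap.smulLeftCLM_apply_apply (weight_hasTemperateGrowth _), norm_smul,
      Real.norm_of_nonneg (hwpos _ x).le]
  have h := integral_mul_norm_le_Lp_mul_Lq (μ := (volume : Measure E)) (f := fun x => (g x : ℂ))
    (g := F) (p := 2) (q := 2) Real.HolderConjugate.two_two
    (by simpa using hgm.ofReal (K := ℂ)) (by simpa using F.memLp 2)
  have hgn : ∀ x, ‖(g x : ℂ)‖ = g x := fun x => by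
    rw [Complex.norm_real, Real.norm_of_nonneg (inv_nonneg.2 (hwpos _ x).le)]
  simp only [hgn] at h
  rw [SchwartzMap.norm_toLp' (by norm_num) (by norm_num)]
  simp only [ENNReal.toReal_ofNat]
  rw [← one_div]
  refine le_trans (le_of_eq ?_) h
  refine integral_congr_ae (Filter.Eventually.of_forall fun x => ?_)
  have := (hwpos d x).ne'
  simp only [hFn, hg]
  rw [show weight E (N + d) x = weight E N x * weight E d x from pow_add _ _ _]
  field_simp

/-- A functional controlled by a linear map into a Hilbert space is represented by a vector of
that space. -/
theorem exists_inner_eq_of_norm_le {V H : Type*} [AddCommGroup V] [Module ℂ V]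
    [NormedAddCommGroup H] [InnerProductSpace ℂ H] [CompleteSpace H] (J : V →ₗ[ℂ] H)
    (L : V →ₗ[ℂ] ℂ) (C : ℝ) (hL : ∀ v, ‖L v‖ ≤ C * ‖J v‖) :
    ∃ g : H, ∀ v, L v = inner ℂ g (J v) := by
  have hker : J.ker ≤ L.ker := fun v hv => by
    have := hL v
    rw [LinearMap.mem_ker.1 hv] at this
    simpa using this
  let L₀ : J.range →ₗ[ℂ] ℂ := (J.ker.liftQ L hker) ∘ₗ J.quotKerEquivRange.symm.toLinearMap
  have hL₀ : ∀ v, L₀ ⟨J v, v, rfl⟩ = L v := fun v => by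
    have : J.quotKerEquivRange.symm ⟨J v, v, rfl⟩ = J.ker.mkQ v :=
      LinearMap.quotKerEquivRange_symm_apply_image J v _
    simp [L₀, this]
  have hb : ∀ y : J.range, ‖L₀ y‖ ≤ C * ‖y‖ := by
    rintro ⟨_, v, rfl⟩
    rw [hL₀]
    exact hL v
  obtain ⟨G, hG, -⟩ := exists_extension_norm_eq J.range (L₀.mkContinuous C hb)
  refine ⟨(InnerProductSpace.toDual ℂ H).symm G, fun v => ?_⟩
  rw [InnerProductSpace.toDual_symm_apply]
  have := hG ⟨J v, v, rfl⟩
  rw [this]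
  exact (hL₀ v).symm

/-- A tempered distribution multiplied by a Schwartz function is obtained from a square-integrable
function by a power of the elliptic operator with symbol `1 + |ξ|²`. -/
theorem exists_sq_integrable_representation (T : 𝓢'(E, ℂ)) (η : 𝓢(E, ℂ)) :
    ∃ (h : E → ℂ) (M : ℕ), MemLp h 2 ∧ ∀ ψ : 𝓢(E, ℂ), T (SchwartzMap.smulLeftCLM ℂ η ψ) =
      ∫ x, h x * SchwartzMap.fourierMultiplierCLM ℂ (weight E M) ψ x := by
  obtain ⟨C₁, N, hC₁, h₁⟩ := exists_order_bound T η
  obtain ⟨C₂, M, hC₂, h₂⟩ := exists_integral_weight_le (E := E) N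
  set W := SchwartzMap.fourierMultiplierCLM ℂ fun x : E => (weight E M x : ℂ) with hW
  have hWr : ∀ ψ, SchwartzMap.fourierMultiplierCLM ℂ (weight E M) ψ = W ψ := fun ψ =>
    (SchwartzMap.fourierMultiplierCLM_ofReal ℂ (weight_hasTemperateGrowth M) ψ).symm
  have hb : ∀ ψ : 𝓢(E, ℂ), ‖T (SchwartzMap.smulLeftCLM ℂ η ψ)‖ ≤
      (C₁ * ∑ i ∈ Finset.range (N + 1), (2 * Real.pi) ^ i * ((i + 1 : ℕ) * C₂)) *
        ‖(W ψ).toLp 2‖ := by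
    intro ψ
    have hn : ‖(W ψ).toLp 2‖ = ‖(SchwartzMap.smulLeftCLM ℂ (weight E M) (𝓕 ψ)).toLp 2‖ := by
      rw [← SchwartzMap.norm_fourier_toL2_eq (W ψ), ← hWr, SchwartzMap.fourierMultiplierCLM_apply]
      simp
    rw [hn]
    refine (h₁ ψ).trans ?_
    rw [mul_assoc, Finset.sum_mul]
    refine mul_le_mul_of_nonneg_left (Finset.sum_le_sum fun i hi => ?_) hC₁
    have h3 := seminorm_fourierInv_le (i := i) (N := N)
      (by simp only [Finset.mem_range] at hi; omega) (𝓕 ψ)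
    simp only [FourierTransform.fourierInv_fourier_eq] at h3
    refine h3.trans ?_
    have h4 := h₂ (𝓕 ψ)
    calc _ ≤ (2 * Real.pi) ^ i * ((i + 1 : ℕ) *
          (C₂ * ‖(SchwartzMap.smulLeftCLM ℂ (weight E M) (𝓕 ψ)).toLp 2‖)) := by gcongr
      _ = _ := by ring
  obtain ⟨g, hg⟩ := exists_inner_eq_of_norm_le
    ((SchwartzMap.toLpCLM ℂ ℂ 2 (volume : Measure E)).toLinearMap ∘ₗ W.toLinearMap)
    ((T : 𝓢(E, ℂ) →ₗ[ℂ] ℂ) ∘ₗ (SchwartzMap.smulLeftCLM ℂ η).toLinearMap) _ hb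
  refine ⟨star g, M, (Lp.memLp g).star, fun ψ => (hg ψ).trans ?_⟩
  rw [L2.inner_def]
  refine integral_congr_ae ?_
  filter_upwards [(W ψ).coeFn_toLp 2 volume] with x hx
  simp only [LinearMap.comp_apply, ContinuousLinearMap.coe_coe, SchwartzMap.toLpCLM_apply, hx, hWr]
  rw [RCLike.inner_apply, mul_comm]
  rfl

end Order

/-! ### Entire functions of exponential type -/

/-- Entire functions of one variable with `|F z| ≤ A exp (B |z|)`. -/
structure IsExpType (F : ℂ → ℂ) : Prop where
  differentiable : Differentiable ℂ F
  bound : ∃ A B : ℝ, ∀ z, ‖F z‖ ≤ A * Real.exp (B * ‖z‖)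

namespace IsExpType

theorem exists_bound {F : ℂ → ℂ} (hF : IsExpType F) :
    ∃ A B : ℝ, 0 ≤ A ∧ 0 ≤ B ∧ ∀ z, ‖F z‖ ≤ A * Real.exp (B * ‖z‖) := by
  obtain ⟨A, B, h⟩ := hF.bound
  have hA : 0 ≤ A := by simpa using (norm_nonneg _).trans (h 0)
  refine ⟨A, |B|, hA, abs_nonneg _, fun z => (h z).trans ?_⟩
  gcongr
  exact le_abs_self B

theorem const (c : ℂ) : IsExpType fun _ => c :=
  ⟨differentiable_const c, ‖c‖, 0, fun z => by simp⟩

theorem id : IsExpType fun z => z :=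
  ⟨differentiable_id, 1, 1, fun z => by
    have := Real.add_one_le_exp ‖z‖
    simp only [one_mul]
    linarith⟩

theorem add {F G : ℂ → ℂ} (hF : IsExpType F) (hG : IsExpType G) :
    IsExpType fun z => F z + G z := by
  obtain ⟨A, B, hA, hB, h⟩ := hF.exists_bound
  obtain ⟨A', B', hA', hB', h'⟩ := hG.exists_bound
  refine ⟨hF.differentiable.add hG.differentiable, A + A', B + B', fun z => ?_⟩
  rw [add_mul]
  refine norm_add_le_of_le ((h z).trans ?_) ((h' z).trans ?_)
  · gcongr
    linarith
  · gcongr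
    linarith

theorem mul {F G : ℂ → ℂ} (hF : IsExpType F) (hG : IsExpType G) :
    IsExpType fun z => F z * G z := by
  obtain ⟨A, B, hA, hB, h⟩ := hF.exists_bound
  obtain ⟨A', B', hA', hB', h'⟩ := hG.exists_bound
  refine ⟨hF.differentiable.mul hG.differentiable, A * A', B + B', fun z => ?_⟩
  rw [norm_mul, add_mul, Real.exp_add, mul_mul_mul_comm]
  gcongr
  · exact h z
  · exact h' z

theorem neg {F : ℂ → ℂ} (hF : IsExpType F) : IsExpType fun z => -F z := by
  simpa using (const (-1)).mul hF

theorem sub {F G : ℂ → ℂ} (hF : IsExpType F) (hG : IsExpType G) :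
    IsExpType fun z => F z - G z := by
  simpa [sub_eq_add_neg] using hF.add hG.neg

theorem comp_const_mul {F : ℂ → ℂ} (hF : IsExpType F) (c : ℂ) :
    IsExpType fun z => F (c * z) := by
  obtain ⟨A, B, h⟩ := hF.bound
  refine ⟨hF.differentiable.comp (differentiable_id.const_mul c), A, B * ‖c‖, fun z => ?_⟩
  have := h (c * z)
  rwa [norm_mul, ← mul_assoc] at this

/-- The Schwarz reflection `z ↦ conj (F (conj z))`. -/
theorem conj_conj {F : ℂ → ℂ} (hF : IsExpType F) :
    IsExpType fun z => (starRingEnd ℂ) (F ((starRingEnd ℂ) z)) := by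
  obtain ⟨A, B, h⟩ := hF.bound
  refine ⟨fun z => ?_, A, B, fun z => ?_⟩
  · have := (hF.differentiable ((starRingEnd ℂ) z)).conj_conj
    rwa [Complex.conj_conj] at this
  have := h ((starRingEnd ℂ) z)
  rwa [RCLike.norm_conj] at this ⊢

end IsExpType

/-! ### Fourier transforms of compactly supported distributions -/

section PaleyWiener

variable {E : Type*} [NormedAddCommGroup E] [InnerProductSpace ℝ E]

/-- The class of functions containing the Fourier transforms of compactly supported
distributions: smooth functions of polynomial growth whose restriction to every real line extends
to an entire function of exponential type. -/
structure IsPaleyWiener (f : E → ℂ) : Prop where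
  contDiff : ContDiff ℝ ∞ f
  growth : ∃ (C : ℝ) (N : ℕ), ∀ x, ‖f x‖ ≤ C * (1 + ‖x‖) ^ N
  line : ∀ x v : E, ∃ F : ℂ → ℂ, IsExpType F ∧ ∀ s : ℝ, F s = f (x + s • v)

namespace IsPaleyWiener

theorem exists_growth {f : E → ℂ} (hf : IsPaleyWiener f) :
    ∃ (C : ℝ) (N : ℕ), 0 ≤ C ∧ ∀ x, ‖f x‖ ≤ C * (1 + ‖x‖) ^ N := by
  obtain ⟨C, N, h⟩ := hf.growth
  exact ⟨C, N, by simpa using (norm_nonneg _).trans (h 0), h⟩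

theorem add {f g : E → ℂ} (hf : IsPaleyWiener f) (hg : IsPaleyWiener g) :
    IsPaleyWiener fun x => f x + g x := by
  refine ⟨hf.contDiff.add hg.contDiff, ?_, fun x v => ?_⟩
  · obtain ⟨C, N, hC, h⟩ := hf.exists_growth
    obtain ⟨C', N', hC', h'⟩ := hg.exists_growth
    refine ⟨C + C', N + N', fun x => ?_⟩
    have h1 : 1 ≤ 1 + ‖x‖ := by linarith [norm_nonneg x]
    rw [add_mul]
    refine norm_add_le_of_le ((h x).trans ?_) ((h' x).trans ?_)
    · gcongr
      · omega
    · gcongr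
      · omega
  · obtain ⟨F, hF, hFs⟩ := hf.line x v
    obtain ⟨G, hG, hGs⟩ := hg.line x v
    exact ⟨_, hF.add hG, fun s => by rw [hFs, hGs]⟩

theorem zero : IsPaleyWiener fun _ : E => (0 : ℂ) :=
  ⟨contDiff_const, ⟨0, 0, by simp⟩, fun _ _ => ⟨_, IsExpType.const 0, fun _ => rfl⟩⟩

theorem const_mul {f : E → ℂ} (hf : IsPaleyWiener f) (c : ℂ) :
    IsPaleyWiener fun x => c * f x := by
  refine ⟨contDiff_const.mul hf.contDiff, ?_, fun x v => ?_⟩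
  · obtain ⟨C, N, hC, h⟩ := hf.exists_growth
    refine ⟨‖c‖ * C, N, fun x => ?_⟩
    rw [norm_mul, mul_assoc]
    gcongr
    exact h x
  · obtain ⟨F, hF, hFs⟩ := hf.line x v
    exact ⟨_, (IsExpType.const c).mul hF, fun s => by rw [hFs]⟩

theorem inner_mul {f : E → ℂ} (hf : IsPaleyWiener f) (w : E) :
    IsPaleyWiener fun x => (inner ℝ x w : ℂ) * f x := by
  refine ⟨(Complex.ofRealCLM.contDiff.comp (contDiff_id.inner ℝ contDiff_const)).mul hf.contDiff,
    ?_, fun x v => ?_⟩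
  · obtain ⟨C, N, hC, h⟩ := hf.exists_growth
    refine ⟨‖w‖ * C, N + 1, fun x => ?_⟩
    rw [norm_mul, Complex.norm_real]
    have h1 : ‖inner ℝ x w‖ ≤ (1 + ‖x‖) * ‖w‖ := (norm_inner_le_norm x w).trans (by
      gcongr
      linarith)
    calc ‖inner ℝ x w‖ * ‖f x‖ ≤ ((1 + ‖x‖) * ‖w‖) * (C * (1 + ‖x‖) ^ N) := by
          gcongr
          exact h x
      _ = _ := by ring
  · obtain ⟨F, hF, hFs⟩ := hf.line x v
    refine ⟨_, ((IsExpType.const (inner ℝ x w : ℂ)).add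
      (IsExpType.id.mul (IsExpType.const (inner ℝ v w : ℂ)))).mul hF, fun s => ?_⟩
    rw [hFs, inner_add_left, real_inner_smul_left]
    push_cast
    rfl

theorem comp_smul {f : E → ℂ} (hf : IsPaleyWiener f) (r : ℝ) :
    IsPaleyWiener fun x => f (r • x) := by
  refine ⟨hf.contDiff.comp (contDiff_const_smul r), ?_, fun x v => ?_⟩
  · obtain ⟨C, N, hC, h⟩ := hf.exists_growth
    refine ⟨C * (1 + |r|) ^ N, N, fun x => (h _).trans ?_⟩
    rw [mul_assoc, ← mul_pow, norm_smul, Real.norm_eq_abs]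
    gcongr
    nlinarith [norm_nonneg x, abs_nonneg r]
  · obtain ⟨F, hF, hFs⟩ := hf.line (r • x) (r • v)
    refine ⟨F, hF, fun s => ?_⟩
    rw [hFs, smul_add, smul_comm]

variable [FiniteDimensional ℝ E] [MeasurableSpace E] [BorelSpace E]

theorem integrable_mul {f : E → ℂ} (hf : IsPaleyWiener f) (φ : 𝓢(E, ℂ)) :
    Integrable fun x => φ x * f x := by
  obtain ⟨C, N, hC, h⟩ := hf.exists_growth
  have h1 : ∀ x, ‖f x‖ ≤ C * (2 ^ N * weight E N x) := by
    intro x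
    refine (h x).trans ?_
    gcongr
    rw [weight, ← mul_pow]
    gcongr
    nlinarith [sq_nonneg (‖x‖ - 1), norm_nonneg x]
  refine ((integrable_weight_mul φ N).const_mul (C * 2 ^ N)).mono'
    (φ.continuous.mul hf.contDiff.continuous).aestronglyMeasurable
    (Filter.Eventually.of_forall fun x => ?_)
  rw [norm_mul]
  calc ‖φ x‖ * ‖f x‖ ≤ ‖φ x‖ * (C * (2 ^ N * weight E N x)) := by gcongr; exact h1 x
    _ = _ := by ring

/-- The Fourier transform of a compactly supported integrable function. -/
theorem fourier_of_bounded_support {g : E → ℂ} (hg : Integrable g) {R : ℝ}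
    (hR : ∀ x, R < ‖x‖ → g x = 0) : IsPaleyWiener (𝓕 g) := by
  refine ⟨?_, ⟨∫ x, ‖g x‖, 0, fun y => ?_⟩, fun x v => ?_⟩
  · refine Real.contDiff_fourier (N := ⊤) fun n _ => ?_
    refine (hg.norm.const_mul (|R| ^ n)).mono'
      ((continuous_norm.pow n).aestronglyMeasurable.mul hg.norm.aestronglyMeasurable)
      (Filter.Eventually.of_forall fun x => ?_)
    by_cases hx : R < ‖x‖
    · simp [hR x hx]
    · push Not at hx
      rw [Real.norm_of_nonneg (by positivity)]
      gcongr
      exact hx.trans (le_abs_self R)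
  · rw [pow_zero, mul_one, Real.fourier_eq]
    refine (norm_integral_le_integral_norm _).trans (le_of_eq ?_)
    simp
  · set B : ℝ := 2 * Real.pi * (|R| * ‖v‖) with hB
    have hB0 : 0 ≤ B := by positivity
    set k : ℂ → E → ℂ := fun z t =>
      Complex.exp (-(2 * Real.pi * Complex.I) * (inner ℝ t x + z * inner ℝ t v)) * g t with hk
    have hkm : ∀ z, AEStronglyMeasurable (k z) := fun z =>
      (Continuous.aestronglyMeasurable (by fun_prop)).mul hg.aestronglyMeasurable
    have hin : ∀ t, ‖t‖ ≤ R → 2 * Real.pi * |inner ℝ t v| ≤ B := by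
      intro t ht
      rw [hB]
      gcongr
      exact (abs_real_inner_le_norm t v).trans
        (mul_le_mul_of_nonneg_right (ht.trans (le_abs_self R)) (norm_nonneg v))
    have hkb : ∀ z t, ‖k z t‖ ≤ Real.exp (B * ‖z‖) * ‖g t‖ := by
      intro z t
      by_cases ht : R < ‖t‖
      · simp [hk, hR t ht]
      · push Not at ht
        simp only [hk, norm_mul, Complex.norm_exp]
        gcongr
        have h1 : (-(2 * Real.pi * Complex.I) * (inner ℝ t x + z * inner ℝ t v)).re =
            2 * Real.pi * (z.im * inner ℝ t v) := by
          simp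
        rw [h1]
        calc 2 * Real.pi * (z.im * inner ℝ t v) ≤ 2 * Real.pi * (|z.im| * |inner ℝ t v|) := by
              rw [← abs_mul]
              gcongr
              exact le_abs_self _
          _ = (2 * Real.pi * |inner ℝ t v|) * |z.im| := by ring
          _ ≤ B * ‖z‖ := by
              gcongr
              · exact hin t ht
              · exact Complex.abs_im_le_norm z
    refine ⟨fun z => ∫ t, k z t, ⟨fun z₀ => ?_, ∫ t, ‖g t‖, B, fun z => ?_⟩, fun s => ?_⟩
    · have hder : ∀ z t, HasDerivAt (fun z => k z t)
          (-(2 * Real.pi * Complex.I) * inner ℝ t v * k z t) z := by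
        intro z t
        have := ((((hasDerivAt_id z).mul_const (inner ℝ t v : ℂ)).const_add
          (inner ℝ t x : ℂ)).const_mul (-(2 * Real.pi * Complex.I))).cexp.mul_const (g t)
        refine this.congr_deriv ?_
        simp only [hk, id]
        ring
      refine (hasDerivAt_integral_of_dominated_loc_of_deriv_le (μ := volume) (F := k)
        (F' := fun z t => -(2 * Real.pi * Complex.I) * inner ℝ t v * k z t)
        (bound := fun t => B * (Real.exp (B * (‖z₀‖ + 1)) * ‖g t‖))
        (Metric.ball_mem_nhds z₀ one_pos) (Filter.Eventually.of_forall hkm)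
        ((hg.norm.const_mul _).mono' (hkm z₀) (Filter.Eventually.of_forall (hkb z₀)))
        ((Continuous.aestronglyMeasurable (by fun_prop)).mul (hkm z₀))
        (Filter.Eventually.of_forall fun t z hz => ?_)
        ((hg.norm.const_mul _).const_mul _)
        (Filter.Eventually.of_forall fun t z _ => hder z t)).2.differentiableAt
      have hz' : ‖z‖ ≤ ‖z₀‖ + 1 := by
        have h1 : ‖z - z₀‖ < 1 := by simpa [dist_eq_norm] using hz
        have h2 := norm_le_norm_add_norm_sub' z z₀
        linarith
      by_cases ht : R < ‖t‖
      · simp [hk, hR t ht]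
      · push Not at ht
        rw [norm_mul]
        gcongr
        · refine le_trans (le_of_eq ?_) (hin t ht)
          simp [abs_of_pos Real.pi_pos]
        · refine (hkb z t).trans ?_
          gcongr
    · rw [mul_comm, ← integral_const_mul]
      exact norm_integral_le_of_norm_le (hg.norm.const_mul _)
        (Filter.Eventually.of_forall (hkb z))
    · rw [Real.fourier_eq']
      refine integral_congr_ae (Filter.Eventually.of_forall fun t => ?_)
      simp only [hk, smul_eq_mul, inner_add_right, real_inner_smul_right]
      congr 2
      push_cast
      ring

end IsPaleyWiener

end PaleyWiener

section FourierRepresentation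

open LineDeriv

variable {E : Type*} [NormedAddCommGroup E] [InnerProductSpace ℝ E] [FiniteDimensional ℝ E]
  [MeasurableSpace E] [BorelSpace E]

/-- A functional on Schwartz functions whose products with compactly supported smooth functions
have Paley-Wiener functions as Fourier transforms. -/
def HasLocalPaleyWiener (u : 𝓢(E, ℂ) →ₗ[ℝ] ℂ) : Prop :=
  ∀ η : 𝓢(E, ℂ), HasCompactSupport η → ∃ f : E → ℂ, IsPaleyWiener f ∧ ∀ φ : 𝓢(E, ℂ),
    u (SchwartzMap.smulLeftCLM ℂ η (𝓕 φ)) = ∫ x, φ x * f x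

namespace HasLocalPaleyWiener

theorem zero : HasLocalPaleyWiener (0 : 𝓢(E, ℂ) →ₗ[ℝ] ℂ) := fun _ _ =>
  ⟨_, IsPaleyWiener.zero, fun φ => by simp⟩

theorem add {u v : 𝓢(E, ℂ) →ₗ[ℝ] ℂ} (hu : HasLocalPaleyWiener u) (hv : HasLocalPaleyWiener v) :
    HasLocalPaleyWiener (u + v) := by
  intro η hη
  obtain ⟨f, hf, hfu⟩ := hu η hη
  obtain ⟨g, hg, hgv⟩ := hv η hη
  refine ⟨_, hf.add hg, fun φ => ?_⟩
  rw [LinearMap.add_apply, hfu, hgv, ← integral_add (hf.integrable_mul φ) (hg.integrable_mul φ)]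
  simp only [mul_add]

theorem smul {u : 𝓢(E, ℂ) →ₗ[ℝ] ℂ} (hu : HasLocalPaleyWiener u) (c : ℝ) :
    HasLocalPaleyWiener (c • u) := by
  intro η hη
  obtain ⟨f, hf, hfu⟩ := hu η hη
  refine ⟨_, hf.const_mul c, fun φ => ?_⟩
  rw [LinearMap.smul_apply, hfu, Complex.real_smul, ← integral_const_mul]
  simp only [mul_left_comm]

theorem sum {ι : Type*} (s : Finset ι) {u : ι → 𝓢(E, ℂ) →ₗ[ℝ] ℂ}
    (hu : ∀ i ∈ s, HasLocalPaleyWiener (u i)) : HasLocalPaleyWiener (∑ i ∈ s, u i) :=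
  Finset.sum_induction _ _ (fun _ _ => add) zero hu

/-- Leibniz' rule moves a derivative either to the cutoff or, as a linear factor, to the Fourier
side. -/
theorem comp_lineDeriv {u : 𝓢(E, ℂ) →ₗ[ℝ] ℂ} (hu : HasLocalPaleyWiener u) (w : E) :
    HasLocalPaleyWiener (u ∘ₗ (lineDerivOpCLM ℝ 𝓢(E, ℂ) w).toLinearMap) := by
  intro η hη
  have hη' : HasCompactSupport (∂_{w} η : 𝓢(E, ℂ)) :=
    hη.mono' ((subset_tsupport _).trans (SchwartzMap.tsupport_lineDerivOp_subset w η))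
  obtain ⟨f, hf, hfu⟩ := hu η hη
  obtain ⟨g, hg, hgu⟩ := hu _ hη'
  have hi : (fun x : E => inner ℝ x w).HasTemperateGrowth := by fun_prop
  refine ⟨_, hg.add ((hf.inner_mul w).const_mul (-(2 * Real.pi * Complex.I))), fun φ => ?_⟩
  set φ' : 𝓢(E, ℂ) :=
    -(2 * Real.pi * Complex.I) • SchwartzMap.smulLeftCLM ℂ (inner ℝ · w) φ with hφ'
  have hleib : (∂_{w} (SchwartzMap.smulLeftCLM ℂ η (𝓕 φ : 𝓢(E, ℂ))) : 𝓢(E, ℂ)) =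
      SchwartzMap.smulLeftCLM ℂ (∂_{w} η : 𝓢(E, ℂ)) (𝓕 φ) +
        SchwartzMap.smulLeftCLM ℂ η (𝓕 φ') := by
    have hF : (𝓕 φ' : 𝓢(E, ℂ)) = ∂_{w} (𝓕 φ : 𝓢(E, ℂ)) :=
      (SchwartzMap.lineDerivOp_fourier_eq φ w).symm
    rw [hF]
    ext x
    have hfun : ⇑(SchwartzMap.smulLeftCLM ℂ η (𝓕 φ : 𝓢(E, ℂ))) =
        fun y => η y * (𝓕 φ : 𝓢(E, ℂ)) y := by
      ext y
      simp [SchwartzMap.smulLeftCLM_apply_apply η.hasTemperateGrowth]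
    rw [SchwartzMap.lineDerivOp_apply_eq_fderiv, hfun, _root_.add_apply,
      SchwartzMap.smulLeftCLM_apply_apply η.hasTemperateGrowth,
      SchwartzMap.smulLeftCLM_apply_apply (SchwartzMap.hasTemperateGrowth _),
      SchwartzMap.lineDerivOp_apply_eq_fderiv, SchwartzMap.lineDerivOp_apply_eq_fderiv,
      fderiv_fun_mul η.differentiableAt (SchwartzMap.differentiableAt _)]
    simp only [_root_.add_apply, _root_.smul_apply, smul_eq_mul]
    ring
  have hint : ∫ x, φ' x * f x =
      ∫ x, φ x * (-(2 * Real.pi * Complex.I) * ((inner ℝ x w : ℂ) * f x)) := by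
    refine integral_congr_ae (Filter.Eventually.of_forall fun x => ?_)
    simp only [hφ', _root_.smul_apply, SchwartzMap.smulLeftCLM_apply_apply hi, smul_eq_mul,
      Complex.real_smul]
    ring
  rw [LinearMap.comp_apply, ContinuousLinearMap.coe_coe, lineDerivOpCLM_apply, hleib, map_add,
    hgu, hfu, hint, ← integral_add (hg.integrable_mul φ)
      (((hf.inner_mul w).const_mul _).integrable_mul φ)]
  simp only [mul_add]

end HasLocalPaleyWiener

theorem integrable_mul_schwartz {h : E → ℂ} (hh : MemLp h 2) (ψ : 𝓢(E, ℂ)) :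
    Integrable fun x => h x * ψ x :=
  hh.integrable_mul (ψ.memLp 2)

/-- Integration against a square-integrable function. -/
def integralLM (h : E → ℂ) (hh : MemLp h 2) : 𝓢(E, ℂ) →ₗ[ℝ] ℂ where
  toFun ψ := ∫ x, h x * ψ x
  map_add' ψ ψ' := by
    rw [← integral_add (integrable_mul_schwartz hh ψ) (integrable_mul_schwartz hh ψ')]
    simp only [_root_.add_apply, mul_add]
  map_smul' c ψ := by
    rw [RingHom.id_apply, ← integral_smul]
    simp only [_root_.smul_apply, mul_smul_comm]

theorem hasLocalPaleyWiener_integralLM {h : E → ℂ} (hh : MemLp h 2) :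
    HasLocalPaleyWiener (integralLM h hh) := by
  intro η hη
  have hg : Integrable fun x => h x * η x := integrable_mul_schwartz hh η
  obtain ⟨R, hR⟩ := hη.isCompact.isBounded.subset_closedBall (0 : E)
  refine ⟨𝓕 fun x => h x * η x, IsPaleyWiener.fourier_of_bounded_support hg (R := R)
    fun x hx => ?_, fun φ => ?_⟩
  · have : x ∉ tsupport η := fun hx' => by
      have := hR hx'
      simp only [Metric.mem_closedBall, dist_zero_right] at this
      linarith
    simp [image_eq_zero_of_notMem_tsupport this]
  · have key := VectorFourier.integral_fourierIntegral_smul_eq_flip (L := innerₗ E)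
      (μ := (volume : Measure E)) (ν := (volume : Measure E))
      Real.continuous_fourierChar (by exact continuous_inner) (φ.integrable (μ := volume)) hg
    rw [flip_innerₗ] at key
    simp only [smul_eq_mul] at key
    refine Eq.trans ?_ key
    refine integral_congr_ae (Filter.Eventually.of_forall fun x => ?_)
    simp only [SchwartzMap.smulLeftCLM_apply_apply η.hasTemperateGrowth, SchwartzMap.fourier_coe,
      smul_eq_mul, Real.fourier_eq, VectorFourier.fourierIntegral, innerₗ_apply_apply]
    ring

theorem fourierMultiplierCLM_weight_succ (M : ℕ) (ψ : 𝓢(E, ℂ)) :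
    SchwartzMap.fourierMultiplierCLM ℂ (weight E (M + 1)) ψ =
      SchwartzMap.fourierMultiplierCLM ℂ (weight E M) ψ -
        ((2 * Real.pi) ^ 2)⁻¹ • ∑ i, SchwartzMap.fourierMultiplierCLM ℂ (weight E M)
          (∂_{stdOrthonormalBasis ℝ E i} (∂_{stdOrthonormalBasis ℝ E i} ψ : 𝓢(E, ℂ))) := by
  have hn := Function.hasTemperateGrowth_norm_sq (H := E)
  have hΔ := SchwartzMap.laplacian_eq_sum (stdOrthonormalBasis ℝ E) ψ
  rw [SchwartzMap.laplacian_eq_fourierMultiplierCLM] at hΔ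
  rw [← map_sum, ← hΔ, map_smul, smul_smul,
    SchwartzMap.fourierMultiplierCLM_fourierMultiplierCLM_apply (weight_hasTemperateGrowth M) hn]
  have h1 : ((2 * Real.pi) ^ 2)⁻¹ * -(2 * Real.pi) ^ 2 = -1 := by
    have := Real.pi_pos
    field_simp
  rw [h1, neg_one_smul, sub_neg_eq_add]
  have hw : weight E (M + 1) = weight E M + weight E M * fun x => ‖x‖ ^ 2 := by
    ext x
    simp only [weight, Pi.add_apply, Pi.mul_apply]
    ring
  simp only [SchwartzMap.fourierMultiplierCLM_apply]
  rw [hw, SchwartzMap.smulLeftCLM_add (weight_hasTemperateGrowth M)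
    ((weight_hasTemperateGrowth M).mul hn), _root_.add_apply, FourierTransform.fourierInv_add]

theorem hasLocalPaleyWiener_fourierMultiplier {h : E → ℂ} (hh : MemLp h 2) (M : ℕ) :
    HasLocalPaleyWiener
      (integralLM h hh ∘ₗ (SchwartzMap.fourierMultiplierCLM ℂ (weight E M)).toLinearMap) := by
  induction M with
  | zero =>
    have : (SchwartzMap.fourierMultiplierCLM ℂ (weight E 0)).toLinearMap =
        (LinearMap.id : 𝓢(E, ℂ) →ₗ[ℝ] 𝓢(E, ℂ)) := by
      have hw : weight E 0 = fun _ => (1 : ℝ) := by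
        ext x
        simp [weight]
      rw [hw, SchwartzMap.fourierMultiplierCLM_const]
      ext
      simp
    rw [this, LinearMap.comp_id]
    exact hasLocalPaleyWiener_integralLM hh
  | succ M ih =>
    set u := integralLM h hh ∘ₗ (SchwartzMap.fourierMultiplierCLM ℂ (weight E M)).toLinearMap
      with hu
    have hs : integralLM h hh ∘ₗ
        (SchwartzMap.fourierMultiplierCLM ℂ (weight E (M + 1))).toLinearMap =
        u + (-((2 * Real.pi) ^ 2)⁻¹) • ∑ i,
          (u ∘ₗ (lineDerivOpCLM ℝ 𝓢(E, ℂ) (stdOrthonormalBasis ℝ E i)).toLinearMap) ∘ₗ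
            (lineDerivOpCLM ℝ 𝓢(E, ℂ) (stdOrthonormalBasis ℝ E i)).toLinearMap := by
      refine LinearMap.ext fun ψ => ?_
      simp only [LinearMap.comp_apply, ContinuousLinearMap.coe_coe,
        fourierMultiplierCLM_weight_succ, sub_eq_add_neg, ← neg_smul, map_add, map_smul,
        map_sum, LinearMap.add_apply, LinearMap.smul_apply, LinearMap.sum_apply, hu,
        lineDerivOpCLM_apply]
    rw [hs]
    exact ih.add ((HasLocalPaleyWiener.sum _ fun i _ =>
      (ih.comp_lineDeriv _).comp_lineDeriv _).smul _)

/-- The Fourier transform of a compactly supported distribution is a Paley-Wiener function. -/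
theorem exists_paleyWiener_fourier (T : 𝓢'(E, ℂ)) {η θ : 𝓢(E, ℂ)} (hθ : HasCompactSupport θ) :
    ∃ f : E → ℂ, IsPaleyWiener f ∧ ∀ φ : 𝓢(E, ℂ),
      T (SchwartzMap.smulLeftCLM ℂ η (SchwartzMap.smulLeftCLM ℂ θ (𝓕 φ))) =
        ∫ x, φ x * f x := by
  obtain ⟨h, M, hh, hT⟩ := exists_sq_integrable_representation T η
  obtain ⟨f, hf, hfu⟩ := hasLocalPaleyWiener_fourierMultiplier hh M θ hθ
  refine ⟨f, hf, fun φ => ?_⟩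
  rw [hT, ← hfu]
  rfl

end FourierRepresentation

/-! ### Separation of Gaussian growth from exponential type -/

section ExpTypeUniqueness

open Filter Topology

theorem eq_zero_of_eventually_real {F : ℂ → ℂ} (hF : Differentiable ℂ F) (s₀ : ℝ)
    (h : ∀ᶠ s : ℝ in 𝓝 s₀, F s = 0) (z : ℂ) : F z = 0 := by
  have hA : AnalyticOnNhd ℂ F Set.univ := fun x _ => hF.analyticAt x
  have hfr : ∃ᶠ w in 𝓝[≠] (s₀ : ℂ), F w = 0 := by
    have h1 : Tendsto (fun s : ℝ => (s : ℂ)) (𝓝[≠] s₀) (𝓝[≠] (s₀ : ℂ)) := by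
      refine tendsto_nhdsWithin_of_tendsto_nhds_of_eventually_within _
        ((Complex.continuous_ofReal.tendsto _).mono_left nhdsWithin_le_nhds) ?_
      filter_upwards [self_mem_nhdsWithin] with s hs
      simpa using hs
    exact h1.frequently (h.filter_mono nhdsWithin_le_nhds).frequently
  exact hA.eqOn_zero_of_preconnected_of_frequently_eq_zero isPreconnected_univ
    (Set.mem_univ _) hfr (Set.mem_univ z)

/-- The power `z ^ (2 / 3)` maps the right half-plane into the sector `|arg ζ| ≤ π / 3`, where
`|ζ| ≤ 2 Re ζ`. -/
theorem norm_le_two_mul_re_cpow {z : ℂ} (hz : 0 ≤ z.re) :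
    ‖z ^ (2 / 3 : ℂ)‖ ≤ 2 * (z ^ (2 / 3 : ℂ)).re := by
  rcases eq_or_ne z 0 with rfl | h0
  · rw [Complex.zero_cpow (by norm_num)]
    simp
  have harg : |z.arg| ≤ Real.pi / 2 := Complex.abs_arg_le_pi_div_two_iff.2 hz
  have h23 : (2 / 3 : ℂ) = ((2 / 3 : ℝ) : ℂ) := by push_cast; rfl
  have hre : (z ^ (2 / 3 : ℂ)).re = ‖z ^ (2 / 3 : ℂ)‖ * Real.cos (z.arg * (2 / 3)) := by
    rw [Complex.cpow_def_of_ne_zero h0, Complex.norm_exp, Complex.exp_re, h23, Complex.im_mul_ofReal,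
      Complex.log_im]
  have hcos : 1 / 2 ≤ Real.cos (z.arg * (2 / 3)) := by
    rw [← Real.cos_pi_div_three, ← Real.cos_abs (z.arg * (2 / 3))]
    refine Real.cos_le_cos_of_nonneg_of_le_pi (abs_nonneg _) (by linarith [Real.pi_pos]) ?_
    rw [abs_mul, abs_of_pos (by norm_num : (0 : ℝ) < 2 / 3)]
    linarith
  rw [hre]
  nlinarith [norm_nonneg (z ^ (2 / 3 : ℂ))]

/-- An entire function of exponential type with Gaussian decay along a ray vanishes. -/
theorem IsExpType.eq_zero_of_gaussian_decay {A : ℂ → ℂ} (hA : IsExpType A) {δ K₁ K₂ : ℝ}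
    (hδ : 0 < δ) (h : ∀ r : ℝ, 0 ≤ r → ‖A r‖ ≤ K₁ * Real.exp (-δ * r ^ 2 + K₂ * r)) (z : ℂ) :
    A z = 0 := by
  obtain ⟨a, b, ha, hb, hab⟩ := hA.exists_bound
  have hK₁ : 0 ≤ K₁ := by simpa using (norm_nonneg _).trans (h 0 le_rfl)
  -- On the sector `|arg ζ| ≤ π / 3` the factor `exp (-2 b ζ)` compensates the exponential growth;
  -- the substitution `ζ = z ^ (2 / 3)` keeps the decay superexponential.
  set f : ℂ → ℂ := fun z => A (z ^ (2 / 3 : ℂ)) * Complex.exp (-(2 * b) * z ^ (2 / 3 : ℂ)) with hf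
  have hfb : ∀ z : ℂ, 0 ≤ z.re → ‖f z‖ ≤ a := by
    intro z hz
    simp only [hf, norm_mul, Complex.norm_exp]
    have h1 := norm_le_two_mul_re_cpow hz
    have h2 : (-(2 * (b : ℂ)) * z ^ (2 / 3 : ℂ)).re = -(2 * b) * (z ^ (2 / 3 : ℂ)).re := by
      have : -(2 * (b : ℂ)) = ((-(2 * b) : ℝ) : ℂ) := by push_cast; rfl
      rw [this, Complex.re_ofReal_mul]
    rw [h2]
    refine (mul_le_mul_of_nonneg_right (hab _) (Real.exp_nonneg _)).trans ?_
    rw [mul_assoc, ← Real.exp_add]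
    refine mul_le_of_le_one_right ha (Real.exp_le_one_iff.2 ?_)
    nlinarith
  have hcont : ∀ z : ℂ, 0 ≤ z.re → ContinuousAt f z := by
    intro z hz
    have h1 : ContinuousAt (fun z : ℂ => z ^ (2 / 3 : ℂ)) z :=
      Complex.continuousAt_cpow_const_of_re_pos (Or.inl hz) (by norm_num)
    exact (hA.differentiable.continuous.continuousAt.comp h1).mul
      (Complex.continuous_exp.continuousAt.comp (h1.const_mul _))
  have hdiff : DiffContOnCl ℂ f {z | 0 < z.re} := by
    refine ⟨fun z hz => ?_, fun z hz => (hcont z ?_).continuousWithinAt⟩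
    · have h1 : DifferentiableAt ℂ (fun z : ℂ => z ^ (2 / 3 : ℂ)) z :=
        differentiableAt_id.cpow_const (Or.inl hz)
      exact ((hA.differentiable.differentiableAt.comp z h1).mul
        (h1.const_mul _).cexp).differentiableWithinAt
    · rwa [Complex.closure_setOfPred_lt_re] at hz
  have hzero : Set.EqOn f 0 {z : ℂ | 0 ≤ z.re} := by
    refine PhragmenLindelof.eq_zero_on_right_half_plane_of_superexponential_decay hdiff
      ⟨1, by norm_num, 0, ?_⟩ (fun n => ?_) ⟨a, fun x => hfb _ (by simp)⟩
    · refine Asymptotics.IsBigO.of_bound a ?_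
      filter_upwards [mem_inf_of_right (mem_principal_self _)] with z hz
      simpa using hfb z (le_of_lt hz)
    · set C := |K₂| + 2 * b with hC
      have hlim : Tendsto (fun x : ℝ => K₁ * Real.exp (-x ^ (1 / 3 : ℝ))) atTop (𝓝 0) := by
        simpa using (Real.tendsto_exp_atBot.comp (tendsto_neg_atTop_atBot.comp
          (tendsto_rpow_atTop (by norm_num : (0 : ℝ) < 1 / 3)))).const_mul K₁
      refine squeeze_zero_norm' ?_ hlim
      have hbig := (tendsto_rpow_atTop (by norm_num : (0 : ℝ) < 1 / 3)).eventually_ge_atTop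
        (max 1 ((n + C + 1) / δ))
      filter_upwards [hbig, eventually_ge_atTop 0] with x hx hx0
      set y := x ^ (1 / 3 : ℝ) with hy
      have hy1 : 1 ≤ y := (le_max_left _ _).trans hx
      have hy2 : n + C + 1 ≤ y * δ := (div_le_iff₀ hδ).1 ((le_max_right _ _).trans hx)
      have hyx : y ^ 3 = x := by
        rw [hy, ← Real.rpow_natCast, ← Real.rpow_mul hx0]
        norm_num
      have hpow : ((x : ℂ) ^ (2 / 3 : ℂ)) = ((y ^ 2 : ℝ) : ℂ) := by
        have h23 : (2 / 3 : ℂ) = ((2 / 3 : ℝ) : ℂ) := by push_cast; rfl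
        rw [h23, ← Complex.ofReal_cpow hx0, hy, ← Real.rpow_natCast, ← Real.rpow_mul hx0]
        norm_num
      have hfx : ‖f x‖ ≤ K₁ * Real.exp (-δ * (y ^ 2) ^ 2 + C * y ^ 2) := by
        simp only [hf, hpow, norm_mul, Complex.norm_exp]
        have h2 : (-(2 * (b : ℂ)) * ((y ^ 2 : ℝ) : ℂ)).re = -(2 * b) * y ^ 2 := by
          have : -(2 * (b : ℂ)) * ((y ^ 2 : ℝ) : ℂ) = ((-(2 * b) * y ^ 2 : ℝ) : ℂ) := by
            push_cast; rfl
          rw [this, Complex.ofReal_re]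
        rw [h2]
        refine (mul_le_mul_of_nonneg_right (h _ (sq_nonneg y)) (Real.exp_nonneg _)).trans ?_
        rw [mul_assoc, ← Real.exp_add]
        refine mul_le_mul_of_nonneg_left (Real.exp_le_exp.2 ?_) hK₁
        rw [hC]
        nlinarith [mul_le_mul_of_nonneg_right (le_abs_self K₂) (sq_nonneg y),
          mul_nonneg hb (sq_nonneg y)]
      rw [norm_mul, norm_pow, Real.norm_of_nonneg (Real.exp_nonneg _), norm_norm,
        ← Real.exp_nat_mul, show (n : ℝ) * x = n * y ^ 3 by rw [hyx]]
      refine (mul_le_mul_of_nonneg_left hfx (Real.exp_nonneg _)).trans ?_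
      rw [mul_left_comm, ← Real.exp_add]
      refine mul_le_mul_of_nonneg_left (Real.exp_le_exp.2 ?_) hK₁
      have hC0 : 0 ≤ C := by positivity
      have hn0 : (0 : ℝ) ≤ n := Nat.cast_nonneg n
      have e1 : (n + C + 1) * y ^ 3 ≤ y * δ * y ^ 3 :=
        mul_le_mul_of_nonneg_right hy2 (by positivity)
      have e2 : C * y ^ 2 ≤ C * y ^ 3 :=
        mul_le_mul_of_nonneg_left (pow_le_pow_right₀ hy1 (by norm_num)) hC0
      have e3 : y ≤ y ^ 3 := le_self_pow₀ hy1 (by norm_num)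
      nlinarith
  refine eq_zero_of_eventually_real hA.differentiable 1 ?_ z
  filter_upwards [lt_mem_nhds one_pos] with s hs
  have h1 := hzero (x := ((s ^ (3 / 2 : ℝ) : ℝ) : ℂ)) (by
    simp only [Set.mem_ofPred_eq, Complex.ofReal_re]
    positivity)
  have hpow : (((s ^ (3 / 2 : ℝ) : ℝ) : ℂ) ^ (2 / 3 : ℂ)) = s := by
    have h23 : (2 / 3 : ℂ) = ((2 / 3 : ℝ) : ℂ) := by push_cast; rfl
    rw [h23, ← Complex.ofReal_cpow (by positivity), ← Real.rpow_mul hs.le]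
    norm_num
  simp only [hf, hpow, Pi.zero_apply, mul_eq_zero, Complex.exp_ne_zero, or_false] at h1
  exact h1

/-- Along a ray `ℝ₊ w` with `w² = ∓ i`, the three terms have Gaussian growth of order `exp (t r²)`,
`exp (- t r²)` and `1` respectively, where `t > 0`; so the first coefficient, being of exponential
type, has to vanish. -/
theorem IsExpType.eq_zero_of_gaussian_combination {A B C : ℂ → ℂ} (hA : IsExpType A)
    (hB : IsExpType B) (hC : IsExpType C) {c₁ c₂ γ : ℂ} (hc₁ : c₁ ≠ 0) (hγ : γ.im ≠ 0)
    {q₀ q₁ q₂ : ℝ} (hq : 0 < q₂)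
    (h : ∀ z : ℂ, c₁ * Complex.exp (γ * (q₀ + q₁ * z + q₂ * z ^ 2)) * A z +
      c₂ * Complex.exp ((starRingEnd ℂ) γ * (q₀ + q₁ * z + q₂ * z ^ 2)) * B z + C z = 0) (z : ℂ) :
    A z = 0 := by
  obtain ⟨σ, hσ1, hσγ⟩ : ∃ σ : ℝ, |σ| = 1 ∧ σ * γ.im = |γ.im| := by
    rcases lt_or_gt_of_ne hγ with h | h
    · exact ⟨-1, by simp, by rw [abs_of_neg h]; ring⟩
    · exact ⟨1, by simp, by rw [abs_of_pos h]; ring⟩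
  obtain ⟨w, hw⟩ := IsAlgClosed.exists_pow_nat_eq (-(Complex.I * σ)) (n := 2) (by norm_num)
  have hw1 : ‖w‖ = 1 := by
    have h1 : ‖w‖ ^ 2 = 1 := by
      rw [← norm_pow, hw, norm_neg, norm_mul, Complex.norm_I, Complex.norm_real, Real.norm_eq_abs,
        hσ1, one_mul]
    nlinarith [norm_nonneg w]
  have hw0 : w ≠ 0 := by
    intro h0
    simp [h0] at hw1
  set t := |γ.im| with ht
  have ht0 : 0 < t := abs_pos.2 hγ
  obtain ⟨b₁, b₂, hb₁, hb₂, hBb⟩ := hB.exists_bound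
  obtain ⟨d₁, d₂, hd₁, hd₂, hCb⟩ := hC.exists_bound
  set K := ‖γ‖ * (|q₀| + |q₁|) with hK
  have hK0 : 0 ≤ K := by positivity
  set Q : ℝ → ℂ := fun r => q₀ + q₁ * (w * r) + q₂ * (w * r) ^ 2 with hQ
  have hlow : ∀ (c : ℂ) (r : ℝ), ‖c‖ = ‖γ‖ → 0 ≤ r →
      |(c * Q r).re - q₂ * r ^ 2 * (σ * c.im)| ≤ K * (1 + r) := by
    intro c r hc hr
    have h1 : c * Q r = c * (q₀ + q₁ * (w * r)) + c * (q₂ * (w * r) ^ 2) := by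
      simp only [hQ]; ring
    have h2 : (c * (q₂ * (w * r) ^ 2)).re = q₂ * r ^ 2 * (σ * c.im) := by
      rw [mul_pow, hw]
      have : c * (q₂ * (-(Complex.I * σ) * r ^ 2)) =
          ((-(q₂ * r ^ 2 * σ) : ℝ) : ℂ) * (c * Complex.I) := by
        push_cast; ring
      rw [this, Complex.re_ofReal_mul, Complex.mul_I_re]
      ring
    rw [h1, Complex.add_re, h2, add_sub_cancel_right]
    refine (Complex.abs_re_le_norm _).trans ?_
    rw [norm_mul, hc, hK, mul_assoc]
    refine mul_le_mul_of_nonneg_left ?_ (norm_nonneg _)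
    refine (norm_add_le _ _).trans ?_
    rw [norm_mul, norm_mul, hw1, Complex.norm_real, Complex.norm_real, Complex.norm_real,
      Real.norm_eq_abs, Real.norm_eq_abs, Real.norm_of_nonneg hr]
    nlinarith [abs_nonneg q₀, abs_nonneg q₁, mul_nonneg (abs_nonneg q₀) hr]
  have hdecay : ∀ r : ℝ, 0 ≤ r → ‖A (w * r)‖ ≤
      (‖c₁‖⁻¹ * Real.exp (2 * K) * (‖c₂‖ * b₁ + d₁)) *
        Real.exp (-(q₂ * t) * r ^ 2 + (2 * K + b₂ + d₂) * r) := by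
    intro r hr
    have hnr : ‖w * (r : ℂ)‖ = r := by
      rw [norm_mul, hw1, one_mul, Complex.norm_real, Real.norm_of_nonneg hr]
    have hr2 : 0 ≤ q₂ * r ^ 2 * t := by positivity
    have e1 : q₂ * r ^ 2 * t - K * (1 + r) ≤ (γ * Q r).re := by
      have := (abs_le.1 (hlow γ r rfl hr)).1
      rw [hσγ] at this
      linarith
    have e2 : ((starRingEnd ℂ) γ * Q r).re ≤ K * (1 + r) := by
      have := (abs_le.1 (hlow ((starRingEnd ℂ) γ) r (RCLike.norm_conj γ) hr)).2
      rw [Complex.conj_im, mul_neg, hσγ] at this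
      linarith
    have hz := h (w * r)
    have hz' : c₁ * Complex.exp (γ * Q r) * A (w * r) =
        -(c₂ * Complex.exp ((starRingEnd ℂ) γ * Q r) * B (w * r) + C (w * r)) := by
      rw [eq_neg_iff_add_eq_zero, ← add_assoc]
      exact hz
    have hn := congrArg norm hz'
    rw [norm_neg, norm_mul, norm_mul, Complex.norm_exp] at hn
    have hB' := hBb (w * r)
    have hC' := hCb (w * r)
    rw [hnr] at hB' hC'
    have hup : ‖c₂ * Complex.exp ((starRingEnd ℂ) γ * Q r) * B (w * r) + C (w * r)‖ ≤
        (‖c₂‖ * b₁ + d₁) * Real.exp (K * (1 + r) + (b₂ + d₂) * r) := by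
      rw [add_mul]
      refine norm_add_le_of_le ?_ ?_
      · rw [norm_mul, norm_mul, Complex.norm_exp]
        calc ‖c₂‖ * Real.exp ((starRingEnd ℂ) γ * Q r).re * ‖B (w * r)‖
            ≤ ‖c₂‖ * Real.exp (K * (1 + r)) * (b₁ * Real.exp (b₂ * r)) := by gcongr
          _ = ‖c₂‖ * b₁ * Real.exp (K * (1 + r) + b₂ * r) := by rw [Real.exp_add]; ring
          _ ≤ _ := by
              gcongr
              linarith
      · refine hC'.trans ?_
        gcongr
        nlinarith [mul_nonneg hK0 (by linarith : 0 ≤ 1 + r), mul_nonneg hb₂ hr]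
    have hlow' : ‖c₁‖ * Real.exp (q₂ * r ^ 2 * t - K * (1 + r)) * ‖A (w * r)‖ ≤
        (‖c₂‖ * b₁ + d₁) * Real.exp (K * (1 + r) + (b₂ + d₂) * r) := by
      refine le_trans ?_ (hn.le.trans hup)
      gcongr
    have hc₁' : 0 < ‖c₁‖ := norm_pos_iff.2 hc₁
    have hE : Real.exp (2 * K) * Real.exp (-(q₂ * t) * r ^ 2 + (2 * K + b₂ + d₂) * r) *
        Real.exp (q₂ * r ^ 2 * t - K * (1 + r)) = Real.exp (K * (1 + r) + (b₂ + d₂) * r) := by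
      rw [← Real.exp_add, ← Real.exp_add]
      congr 1
      ring
    rw [← hE] at hlow'
    have hpos := Real.exp_pos (q₂ * r ^ 2 * t - K * (1 + r))
    refine le_of_mul_le_mul_left ?_ (mul_pos hc₁' hpos)
    refine hlow'.trans (le_of_eq ?_)
    field_simp
  have hfin := (hA.comp_const_mul w).eq_zero_of_gaussian_decay (mul_pos hq ht0) hdecay (w⁻¹ * z)
  rwa [mul_inv_cancel_left₀ hw0] at hfin

end ExpTypeUniqueness

/-! ### The propagator and its action on compactly supported distributions -/

section Propagator

open Filter Topology

variable {m : ℕ} {k d : ℝ}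

theorem fresnelSchwartz_apply_eq (hk : 0 < k) (hd : 0 < d) (φ : 𝓢(Lat m, ℂ)) (x : Lat m) :
    fresnelSchwartz m hk hd φ x = fresnelConst m k d * (chirp k d x *
      (𝓕 (SchwartzMap.smulLeftCLM ℂ (chirp k d) φ) : 𝓢(Lat m, ℂ))
        ((k / (2 * Real.pi * d)) • x)) := by
  simp only [fresnelSchwartz, _root_.smul_apply, ContinuousLinearMap.comp_apply,
    SchwartzMap.smulLeftCLM_apply_apply (chirp_hasTemperateGrowth (m := m) k d),
    SchwartzMap.compCLMOfContinuousLinearEquiv_apply, Function.comp_apply,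
    SchwartzMap.fourierTransformCLM_apply, smul_eq_mul]
  rfl

theorem fresnelConst_ne_zero (hk : 0 < k) (hd : 0 < d) : fresnelConst m k d ≠ 0 := by
  refine mul_ne_zero (Complex.exp_ne_zero _) ?_
  have := Real.pi_pos
  have h : 0 < k / (2 * Real.pi * d) := by positivity
  exact_mod_cast (Real.rpow_pos_of_pos h _).ne'

theorem chirp_mul_chirp_neg (x : Lat m) : chirp k d x * chirp (-k) d x = 1 := by
  rw [chirp, chirp, ← Complex.exp_add]
  convert Complex.exp_zero
  push_cast
  ring

theorem chirp_ne_zero (x : Lat m) : chirp k d x ≠ 0 := Complex.exp_ne_zero _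

theorem fresnelSchwartz_surjective (hk : 0 < k) (hd : 0 < d) :
    Function.Surjective (fresnelSchwartz m hk hd) := by
  intro ψ
  have hc := chirp_hasTemperateGrowth (m := m) (-k) d
  set g : 𝓢(Lat m, ℂ) := SchwartzMap.compCLMOfContinuousLinearEquiv ℂ (dilation m hk hd).symm
    (SchwartzMap.smulLeftCLM ℂ (chirp (-k) d) ψ) with hg
  refine ⟨(fresnelConst m k d)⁻¹ • SchwartzMap.smulLeftCLM ℂ (chirp (-k) d) (𝓕⁻ g), ?_⟩
  have h1 : SchwartzMap.smulLeftCLM ℂ (chirp k d)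
      (SchwartzMap.smulLeftCLM ℂ (chirp (-k) d) (𝓕⁻ g : 𝓢(Lat m, ℂ))) = 𝓕⁻ g := by
    ext x
    rw [SchwartzMap.smulLeftCLM_apply_apply (chirp_hasTemperateGrowth k d),
      SchwartzMap.smulLeftCLM_apply_apply hc, smul_eq_mul, smul_eq_mul, ← mul_assoc,
      chirp_mul_chirp_neg, one_mul]
  have h0 := fresnelConst_ne_zero (m := m) hk hd
  ext x
  rw [map_smul, _root_.smul_apply, fresnelSchwartz_apply_eq, h1,
    FourierTransform.fourier_fourierInv_eq, smul_eq_mul, inv_mul_cancel_left₀ h0, hg,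
    SchwartzMap.compCLMOfContinuousLinearEquiv_apply, Function.comp_apply]
  have h2 : (dilation m hk hd).symm ((k / (2 * Real.pi * d)) • x) = x :=
    (dilation m hk hd).symm_apply_apply x
  rw [h2, SchwartzMap.smulLeftCLM_apply_apply hc, smul_eq_mul, ← mul_assoc,
    chirp_mul_chirp_neg, one_mul]

theorem propagated_apply (hk : 0 < k) (hd : 0 < d) (P : Lat m → ℂ) (T : 𝓢'(Lat m, ℂ))
    (φ : 𝓢(Lat m, ℂ)) : propagated hk hd P T φ =
      T (SchwartzMap.smulLeftCLM ℂ P (fresnelSchwartz m hk hd φ)) := rfl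

theorem propagated_add (hk : 0 < k) (hd : 0 < d) (P : Lat m → ℂ) (S T : 𝓢'(Lat m, ℂ)) :
    propagated hk hd P (S + T) = propagated hk hd P S + propagated hk hd P T := by
  simp only [propagated, map_add]

/-- A dilation on the Fourier side is dual to the inverse dilation. -/
theorem exists_fourier_dilation {s : ℝ} (hs : s ≠ 0) (g : 𝓢(Lat m, ℂ)) :
    ∃ g' : 𝓢(Lat m, ℂ), (∀ x, (𝓕 g' : 𝓢(Lat m, ℂ)) x = (𝓕 g : 𝓢(Lat m, ℂ)) (s • x)) ∧
      ∀ f : Lat m → ℂ, ∫ x, g' x * f x = ∫ x, g x * f (s • x) := by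
  let e : Lat m ≃L[ℝ] Lat m := ContinuousLinearEquiv.smulLeft (Units.mk0 s hs)
  have he : ∀ x, e.symm (s • x) = x := fun x => e.symm_apply_apply x
  set c : ℝ := |(s ^ Module.finrank ℝ (Lat m))⁻¹| with hc
  have hg' : ∀ x, (c • SchwartzMap.compCLMOfContinuousLinearEquiv ℂ e.symm g : 𝓢(Lat m, ℂ))
      (s • x) = c * g x := by
    intro x
    simp only [_root_.smul_apply, SchwartzMap.compCLMOfContinuousLinearEquiv_apply,
      Function.comp_apply, he, Complex.real_smul]
  have hc0 : c ≠ 0 := abs_ne_zero.2 (inv_ne_zero (pow_ne_zero _ hs))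
  have hint : ∀ F : Lat m → ℂ, ∫ x, (c : ℂ)⁻¹ * F (s • x) = ∫ x, F x := by
    intro F
    rw [integral_const_mul, Measure.integral_comp_smul, Complex.real_smul, ← hc,
      inv_mul_cancel_left₀ (by exact_mod_cast hc0)]
  have hc0' : (c : ℂ) ≠ 0 := by exact_mod_cast hc0
  refine ⟨c • SchwartzMap.compCLMOfContinuousLinearEquiv ℂ e.symm g, fun x => ?_, fun f => ?_⟩
  · rw [SchwartzMap.fourier_coe, SchwartzMap.fourier_coe, Real.fourier_eq, Real.fourier_eq,
      ← hint]
    refine integral_congr_ae (Eventually.of_forall fun y => ?_)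
    simp only [hg', Circle.smul_def, smul_eq_mul, real_inner_smul_left, real_inner_smul_right]
    field_simp
  · rw [← hint]
    refine integral_congr_ae (Eventually.of_forall fun y => ?_)
    simp only [hg']
    field_simp

/-- The propagated field of a compactly supported distribution is a chirp times a Paley-Wiener
function. -/
theorem exists_propagated_eq (hk : 0 < k) (hd : 0 < d) {P : Lat m → ℂ}
    (hP : P.HasTemperateGrowth) {T : 𝓢'(Lat m, ℂ)} (hT : IsCompact (Distribution.dsupport T)) :
    ∃ f : Lat m → ℂ, IsPaleyWiener f ∧ ∀ φ : 𝓢(Lat m, ℂ),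
      propagated hk hd P T φ = ∫ x, φ x * (fresnelConst m k d * (chirp k d x * f x)) := by
  have hc := chirp_hasTemperateGrowth (m := m) k d
  have hs : k / (2 * Real.pi * d) ≠ 0 := by
    have := Real.pi_pos
    positivity
  obtain ⟨η, hη, hηT⟩ := exists_cutoff_apply_eq hT
  have hPc : (P * chirp k d).HasTemperateGrowth := hP.mul hc
  set θ : 𝓢(Lat m, ℂ) := SchwartzMap.smulLeftCLM ℂ (P * chirp k d) η with hθ
  have hθx : ∀ x, θ x = P x * chirp k d x * η x := fun x => by
    rw [hθ, SchwartzMap.smulLeftCLM_apply_apply hPc]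
    rfl
  have hθc : HasCompactSupport θ := by
    have : ⇑θ = fun x => P x * chirp k d x * η x := funext hθx
    rw [this]
    exact hη.mul_left
  obtain ⟨f, hf, hfT⟩ := exists_paleyWiener_fourier T (η := η) hθc
  refine ⟨fun x => f ((k / (2 * Real.pi * d)) • x), hf.comp_smul _, fun φ => ?_⟩
  obtain ⟨g, hgF, hgi⟩ := exists_fourier_dilation hs (SchwartzMap.smulLeftCLM ℂ (chirp k d) φ)
  have h1 : SchwartzMap.smulLeftCLM ℂ η (SchwartzMap.smulLeftCLM ℂ η
      (SchwartzMap.smulLeftCLM ℂ P (fresnelSchwartz m hk hd φ))) =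
      fresnelConst m k d • SchwartzMap.smulLeftCLM ℂ η (SchwartzMap.smulLeftCLM ℂ θ (𝓕 g)) := by
    ext x
    simp only [_root_.smul_apply, SchwartzMap.smulLeftCLM_apply_apply η.hasTemperateGrowth,
      SchwartzMap.smulLeftCLM_apply_apply θ.hasTemperateGrowth,
      SchwartzMap.smulLeftCLM_apply_apply hP, smul_eq_mul, fresnelSchwartz_apply_eq, hθx, hgF]
    ring
  -- One copy of the cutoff gives finite order; the other one, together with the probe and the
  -- chirp, forms the compactly supported factor `θ`.
  rw [propagated_apply, ← hηT, ← hηT, h1, map_smul, hfT, hgi, smul_eq_mul, ← integral_const_mul]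
  refine integral_congr_ae (Eventually.of_forall fun x => ?_)
  simp only [SchwartzMap.smulLeftCLM_apply_apply hc, smul_eq_mul]
  ring

/-- The propagator is injective, and so is multiplication by a nonvanishing smooth probe on
compactly supported distributions. -/
theorem eq_of_propagated_eq (hk : 0 < k) (hd : 0 < d) {P : Lat m → ℂ}
    (hP : P.HasTemperateGrowth) (hP0 : ∀ x, P x ≠ 0) {S T : 𝓢'(Lat m, ℂ)}
    (hS : IsCompact (Distribution.dsupport S)) (hT : IsCompact (Distribution.dsupport T))
    (h : ∀ φ, propagated hk hd P S φ = propagated hk hd P T φ) : S = T := by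
  have hψ : ∀ ψ, S (SchwartzMap.smulLeftCLM ℂ P ψ) = T (SchwartzMap.smulLeftCLM ℂ P ψ) := by
    intro ψ
    obtain ⟨φ, rfl⟩ := fresnelSchwartz_surjective hk hd ψ
    exact h φ
  have hcut : ∀ η : 𝓢(Lat m, ℂ), HasCompactSupport η → ∀ φ,
      S (SchwartzMap.smulLeftCLM ℂ η φ) = T (SchwartzMap.smulLeftCLM ℂ η φ) := by
    intro η hη φ
    have hcs : HasCompactSupport fun x => (P x)⁻¹ * (η x * φ x) := hη.mul_right.mul_left
    have hcd : ContDiff ℝ ∞ fun x => (P x)⁻¹ * (η x * φ x) :=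
      (hP.1.inv hP0).mul ((η.smooth ⊤).mul (φ.smooth ⊤))
    have : SchwartzMap.smulLeftCLM ℂ η φ =
        SchwartzMap.smulLeftCLM ℂ P (hcs.toSchwartzMap hcd) := by
      ext x
      rw [SchwartzMap.smulLeftCLM_apply_apply η.hasTemperateGrowth,
        SchwartzMap.smulLeftCLM_apply_apply hP, toSchwartzMap_coe, smul_eq_mul, smul_eq_mul,
        mul_inv_cancel_left₀ (hP0 x)]
    rw [this, hψ]
  obtain ⟨η, hη, hηS⟩ := exists_cutoff_apply_eq hS
  obtain ⟨θ, hθ, hθT⟩ := exists_cutoff_apply_eq hT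
  ext φ
  have hcomm : SchwartzMap.smulLeftCLM ℂ η (SchwartzMap.smulLeftCLM ℂ θ φ) =
      SchwartzMap.smulLeftCLM ℂ θ (SchwartzMap.smulLeftCLM ℂ η φ) := by
    ext x
    simp only [SchwartzMap.smulLeftCLM_apply_apply η.hasTemperateGrowth,
      SchwartzMap.smulLeftCLM_apply_apply θ.hasTemperateGrowth, smul_eq_mul]
    ring
  rw [← hηS, hcut η hη, ← hθT, ← hcomm, ← hcut η hη, hηS, hcut θ hθ, hθT]

/-! ### Distributions given by functions -/

theorem eq_of_forall_integral_eq {f g : Lat m → ℂ} (hf : Continuous f) (hg : Continuous g)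
    (h : ∀ φ : 𝓢(Lat m, ℂ), HasCompactSupport φ → ∫ x, φ x * f x = ∫ x, φ x * g x) : f = g := by
  refine (Continuous.ae_eq_iff_eq (volume : Measure (Lat m)) hf hg).1
    (ae_eq_of_integral_contDiff_smul_eq hf.locallyIntegrable hg.locallyIntegrable
      fun u hu huc => ?_)
  have hcs : HasCompactSupport fun x => (u x : ℂ) := huc.comp_left (g := Complex.ofReal) rfl
  have := h (hcs.toSchwartzMap (Complex.ofRealCLM.contDiff.comp hu)) hcs
  simp only [Complex.real_smul]
  exact this

theorem IsGivenBy.eq {T : 𝓢'(Lat m, ℂ)} {f g : Lat m → ℂ} (hf : IsGivenBy T f)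
    (hg : IsGivenBy T g) : f = g :=
  eq_of_forall_integral_eq hf.1.continuous hg.1.continuous fun φ hφ => by
    rw [← hf.2 φ hφ, hg.2 φ hφ]

theorem IsGivenBy.toFunction_eq {T : 𝓢'(Lat m, ℂ)} {f : Lat m → ℂ} (hf : IsGivenBy T f) :
    toFunction T = f := by
  have h : ∃ f, IsGivenBy T f := ⟨f, hf⟩
  rw [toFunction, dif_pos h]
  exact h.choose_spec.eq hf

/-- A tempered distribution given by a bounded function is given by it on all Schwartz
functions. -/
theorem IsGivenBy.apply_eq_of_bounded {T : 𝓢'(Lat m, ℂ)} {f : Lat m → ℂ} (hf : IsGivenBy T f)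
    {C : ℝ} (hC : ∀ x, ‖f x‖ ≤ C) (φ : 𝓢(Lat m, ℂ)) : T φ = ∫ x, φ x * f x := by
  have hm : MemLp f ⊤ (volume : Measure (Lat m)) :=
    memLp_top_of_bound hf.1.continuous.aestronglyMeasurable C (Eventually.of_forall hC)
  set S : 𝓢'(Lat m, ℂ) := Lp.toTemperedDistribution (hm.toLp f) with hS
  have hSφ : ∀ φ, S φ = ∫ x, φ x * f x := by
    intro φ
    rw [hS, Lp.toTemperedDistribution_apply]
    refine integral_congr_ae ?_
    filter_upwards [hm.coeFn_toLp] with x hx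
    rw [hx, smul_eq_mul]
  obtain ⟨χ, hχc, hχ⟩ := exists_cutoff_tendsto (E := Lat m)
  rw [← hSφ]
  refine tendsto_nhds_unique ((T.continuous.tendsto _).comp (hχ φ))
    (((S.continuous.tendsto _).comp (hχ φ)).congr fun n => ?_)
  have hc : HasCompactSupport (SchwartzMap.smulLeftCLM ℂ (χ n) φ) := by
    rw [SchwartzMap.smulLeftCLM_apply (χ n).hasTemperateGrowth]
    exact (hχc n).smul_right
  exact (hSφ _).trans (hf.2 _ hc).symm

end Propagator

/-! ### Background fields of the probes -/

section Background

open Filter Topology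

variable {m : ℕ} {k d : ℝ}

/-- The Gaussian `exp (α |ξ|²)` in the dimensionless coordinates `ξ = (k / d) ^ (1 / 2) x`. -/
def gaussianField (m : ℕ) (k d : ℝ) (α : ℂ) (x : Lat m) : ℂ :=
  Complex.exp (α * ((k / d * ‖x‖ ^ 2 : ℝ) : ℂ))

theorem contDiff_gaussianField (α : ℂ) : ContDiff ℝ ∞ (gaussianField m k d α) :=
  (contDiff_const.mul (Complex.ofRealCLM.contDiff.comp
    (contDiff_const.mul (contDiff_norm_sq ℝ)))).cexp

theorem norm_gaussianField_le (hk : 0 < k) (hd : 0 < d) {α : ℂ} (hα : α.re ≤ 0) (x : Lat m) :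
    ‖gaussianField m k d α x‖ ≤ 1 := by
  rw [gaussianField, Complex.norm_exp, Complex.re_mul_ofReal, Real.exp_le_one_iff]
  exact mul_nonpos_of_nonpos_of_nonneg hα (by positivity)

theorem integrable_mul_gaussianField (hk : 0 < k) (hd : 0 < d) {α : ℂ} (hα : α.re ≤ 0)
    (φ : 𝓢(Lat m, ℂ)) : Integrable fun x => φ x * gaussianField m k d α x :=
  φ.integrable.mul_bdd (c := 1) (contDiff_gaussianField α).continuous.aestronglyMeasurable
    (Eventually.of_forall (norm_gaussianField_le hk hd hα))

theorem integral_gaussian_mul_fourier {b : ℂ} (hb : 0 < b.re) {s : ℝ} (hs : s ≠ 0)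
    (g : 𝓢(Lat m, ℂ)) :
    ∫ x : Lat m, Complex.exp (-b * ‖x‖ ^ 2) * (𝓕 g : 𝓢(Lat m, ℂ)) (s • x) =
      ∫ x, g x * ((Real.pi / b) ^ (m / 2 : ℂ) *
        Complex.exp (-Real.pi ^ 2 * ‖s • x‖ ^ 2 / b)) := by
  obtain ⟨g', hg'F, hg'i⟩ := exists_fourier_dilation hs g
  rw [← hg'i fun x => (Real.pi / b) ^ (m / 2 : ℂ) * Complex.exp (-Real.pi ^ 2 * ‖x‖ ^ 2 / b)]
  have hG : Integrable fun x : Lat m => Complex.exp (-b * ‖x‖ ^ 2) := by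
    simpa using GaussianFourier.integrable_cexp_neg_mul_sq_norm_add hb 0 (0 : Lat m)
  have key := VectorFourier.integral_fourierIntegral_smul_eq_flip (L := innerₗ (Lat m))
    (μ := (volume : Measure (Lat m))) (ν := (volume : Measure (Lat m)))
    Real.continuous_fourierChar (by exact continuous_inner) (g'.integrable (μ := volume)) hG
  rw [flip_innerₗ] at key
  simp only [smul_eq_mul] at key
  refine Eq.trans (integral_congr_ae (Eventually.of_forall fun x => ?_))
    (key.trans (integral_congr_ae (Eventually.of_forall fun x => ?_)))
  · simp only [← hg'F, SchwartzMap.fourier_coe, Real.fourier_eq, VectorFourier.fourierIntegral,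
      innerₗ_apply_apply]
    ring
  · have := fourier_gaussian_innerProductSpace hb x
    rw [Real.fourier_eq, finrank_euclideanSpace_fin] at this
    simp only [VectorFourier.fourierIntegral, innerₗ_apply_apply, this]

theorem chirp_mul_exp (hd : 0 < d) {α b : ℂ} (hb : b ≠ 0)
    (hα : (α - Complex.I / 2) * (4 * b) = -((k / d : ℝ) : ℂ)) (x : Lat m) :
    chirp k d x * Complex.exp (-Real.pi ^ 2 * ‖(k / (2 * Real.pi * d)) • x‖ ^ 2 / b) =
      gaussianField m k d α x := by
  rw [chirp, gaussianField, ← Complex.exp_add]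
  congr 1
  have hpi : (Real.pi : ℂ) ≠ 0 := by exact_mod_cast Real.pi_ne_zero
  have hd' : (d : ℂ) ≠ 0 := by exact_mod_cast hd.ne'
  have h1 : ((‖(k / (2 * Real.pi * d)) • x‖ : ℝ) : ℂ) ^ 2 =
      ((k : ℂ) / d) ^ 2 / (4 * Real.pi ^ 2) * (‖x‖ : ℂ) ^ 2 := by
    rw [norm_smul, Complex.ofReal_mul, mul_pow, ← Complex.ofReal_pow, Real.norm_eq_abs, sq_abs]
    push_cast
    field_simp
    ring
  have h2 : (α - Complex.I / 2) = -((k : ℂ) / d) / (4 * b) := by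
    rw [eq_div_iff (by simpa using hb), hα]
    push_cast
    rfl
  have h3 : α = -((k : ℂ) / d) / (4 * b) + Complex.I / 2 := by rw [← h2]; ring
  rw [h1, h3]
  push_cast
  field_simp
  ring

/-- The propagated field of an integrable Gaussian. -/
theorem integral_gaussian_mul_fresnelSchwartz (hk : 0 < k) (hd : 0 < d) {α b : ℂ}
    (hb : 0 < b.re) (hα : (α - Complex.I / 2) * (4 * b) = -((k / d : ℝ) : ℂ))
    (φ : 𝓢(Lat m, ℂ)) :
    ∫ x, Complex.exp (-b * ‖x‖ ^ 2) * chirp (-k) d x * fresnelSchwartz m hk hd φ x =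
      fresnelConst m k d * (Real.pi / b) ^ (m / 2 : ℂ) * ∫ x, φ x * gaussianField m k d α x := by
  have hs : k / (2 * Real.pi * d) ≠ 0 := by
    have := Real.pi_pos
    positivity
  have hb0 : b ≠ 0 := by
    rintro rfl
    simp at hb
  have h := integral_gaussian_mul_fourier hb hs (SchwartzMap.smulLeftCLM ℂ (chirp k d) φ)
  have h' := congrArg (fun z => fresnelConst m k d * z) h
  simp only [← integral_const_mul] at h' ⊢
  refine Eq.trans (integral_congr_ae (Eventually.of_forall fun x => ?_))
    (h'.trans (integral_congr_ae (Eventually.of_forall fun x => ?_)))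
  · simp only [fresnelSchwartz_apply_eq]
    linear_combination fresnelConst m k d * Complex.exp (-b * ‖x‖ ^ 2) *
      (𝓕 (SchwartzMap.smulLeftCLM ℂ (chirp k d) φ) : 𝓢(Lat m, ℂ))
        ((k / (2 * Real.pi * d)) • x) * chirp_mul_chirp_neg (k := k) (d := d) x
  · simp only [SchwartzMap.smulLeftCLM_apply_apply (chirp_hasTemperateGrowth k d), smul_eq_mul,
      ← chirp_mul_exp hd hb0 hα]
    ring

theorem propagated_oneDist_apply (hk : 0 < k) (hd : 0 < d) {P : Lat m → ℂ}
    (hP : P.HasTemperateGrowth) (φ : 𝓢(Lat m, ℂ)) :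
    propagated hk hd P (oneDist m) φ = ∫ x, P x * fresnelSchwartz m hk hd φ x := by
  rw [propagated_apply]
  refine (Measure.toTemperedDistribution_apply volume _).trans ?_
  simp only [SchwartzMap.smulLeftCLM_apply_apply hP, smul_eq_mul]

/-- The normalization of the propagator: `fresnelConst` times `(2 π i d / k) ^ (m / 2)` is
`exp (i k d)`. -/
theorem fresnelConst_mul_cpow (hk : 0 < k) (hd : 0 < d) :
    fresnelConst m k d * (Real.pi / (-(Complex.I * ((k / (2 * d) : ℝ) : ℂ)))) ^ (m / 2 : ℂ) =
      Complex.exp (Complex.I * ((k * d : ℝ) : ℂ)) := by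
  have hpi := Real.pi_pos
  set s : ℝ := k / (2 * Real.pi * d) with hs
  have hs0 : 0 < s := by positivity
  have h1 : (Real.pi : ℂ) / (-(Complex.I * ((k / (2 * d) : ℝ) : ℂ))) =
      ((s⁻¹ : ℝ) : ℂ) * Complex.I := by
    have hk' : (k : ℂ) ≠ 0 := by exact_mod_cast hk.ne'
    have hd' : (d : ℂ) ≠ 0 := by exact_mod_cast hd.ne'
    have hpi' : (Real.pi : ℂ) ≠ 0 := by exact_mod_cast hpi.ne'
    rw [hs]
    push_cast
    field_simp
    linear_combination -Complex.I_sq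
  have hmul : (((s⁻¹ : ℝ) : ℂ) * Complex.I) ^ (m / 2 : ℂ) =
      ((s⁻¹ : ℝ) : ℂ) ^ (m / 2 : ℂ) * Complex.I ^ (m / 2 : ℂ) := by
    have hsi : 0 < s⁻¹ := inv_pos.2 hs0
    have hne : ((s⁻¹ : ℝ) : ℂ) ≠ 0 := by exact_mod_cast hsi.ne'
    rw [Complex.cpow_def_of_ne_zero (mul_ne_zero hne Complex.I_ne_zero),
      Complex.log_ofReal_mul hsi Complex.I_ne_zero, Complex.cpow_def_of_ne_zero hne,
      Complex.cpow_def_of_ne_zero Complex.I_ne_zero, ← Complex.exp_add, ← Complex.ofReal_log hsi.le]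
    congr 1
    ring
  have hI : Complex.I ^ (m / 2 : ℂ) = Complex.exp (Complex.I * ((m * Real.pi / 4 : ℝ) : ℂ)) := by
    rw [Complex.cpow_def_of_ne_zero Complex.I_ne_zero, Complex.log_I]
    congr 1
    push_cast
    ring
  have hr : ((s⁻¹ : ℝ) : ℂ) ^ (m / 2 : ℂ) = (((s ^ ((m : ℝ) / 2))⁻¹ : ℝ) : ℂ) := by
    rw [← Real.inv_rpow hs0.le, Complex.ofReal_cpow (inv_pos.2 hs0).le]
    push_cast
    rfl
  have hsr : ((s ^ ((m : ℝ) / 2) : ℝ) : ℂ) ≠ 0 := by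
    exact_mod_cast (Real.rpow_pos_of_pos hs0 _).ne'
  rw [h1, hmul, hI, hr, fresnelConst, ← hs, Complex.ofReal_inv]
  rw [show ∀ a b c e : ℂ, a * b * (c * e) = (b * c) * (a * e) by intros; ring,
    mul_inv_cancel₀ hsr, one_mul, ← Complex.exp_add]
  congr 1
  push_cast
  ring

/-- The Fresnel propagator maps the constant `1` to `exp (i k d)`; the oscillatory Gaussian
integral is the limit of damped ones. -/
theorem integral_fresnelSchwartz (hk : 0 < k) (hd : 0 < d) (φ : 𝓢(Lat m, ℂ)) :
    ∫ x, fresnelSchwartz m hk hd φ x =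
      Complex.exp (Complex.I * ((k * d : ℝ) : ℂ)) * ∫ x, φ x := by
  have hκ : 0 < k / (2 * d) := by positivity
  set b₀ : ℂ := -(Complex.I * ((k / (2 * d) : ℝ) : ℂ)) with hb₀
  set b : ℝ → ℂ := fun ε => ε + b₀ with hb
  have hbre : ∀ ε, (b ε).re = ε := fun ε => by
    simp only [hb, hb₀, Complex.add_re, Complex.neg_re, Complex.I_mul_re, Complex.ofReal_im,
      Complex.ofReal_re, neg_zero, add_zero]
  have hbim : ∀ ε, (b ε).im = -(k / (2 * d)) := fun ε => by
    simp only [hb, hb₀, Complex.add_im, Complex.neg_im, Complex.I_mul_im, Complex.ofReal_im,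
      Complex.ofReal_re, zero_add]
  have hb0 : ∀ ε, b ε ≠ 0 := fun ε h => by
    have := hbim ε
    rw [h] at this
    simp at this
    grind
  set α : ℝ → ℂ := fun ε => -((k / d : ℝ) : ℂ) / (4 * b ε) + Complex.I / 2 with hα
  have hαb : ∀ ε, (α ε - Complex.I / 2) * (4 * b ε) = -((k / d : ℝ) : ℂ) := fun ε => by
    have := hb0 ε
    simp only [hα]
    field_simp
    ring
  have hα0 : α 0 = 0 := by
    have hd' : (d : ℂ) ≠ 0 := by exact_mod_cast hd.ne'
    have hk' : (k : ℂ) ≠ 0 := by exact_mod_cast hk.ne'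
    simp only [hα, hb, hb₀]
    push_cast
    rw [zero_add]
    field_simp
    linear_combination 4 * Complex.I_sq
  have hbc : Continuous b := by fun_prop
  have hαc : Continuous α := by
    refine (continuous_const.div (continuous_const.mul hbc) fun ε => ?_).add continuous_const
    simpa using hb0 ε
  have hαre : ∀ ε, 0 ≤ ε → (α ε).re ≤ 0 := by
    intro ε hε
    have h1 : (α ε).re = -(k / d) / 4 * (ε / Complex.normSq (b ε)) := by
      have : α ε = ((-(k / d) / 4 : ℝ) : ℂ) * (b ε)⁻¹ + Complex.I / 2 := by
        have := hb0 ε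
        simp only [hα]
        push_cast
        field_simp
      rw [this, Complex.add_re, Complex.re_ofReal_mul, Complex.inv_re, hbre]
      simp
    rw [h1]
    have : 0 < k / d := by positivity
    exact mul_nonpos_of_nonpos_of_nonneg (by linarith) (div_nonneg hε (Complex.normSq_nonneg _))
  have hleft : Tendsto (fun ε : ℝ => ∫ x, Complex.exp (-b ε * ‖x‖ ^ 2) * chirp (-k) d x *
      fresnelSchwartz m hk hd φ x) (𝓝[>] 0) (𝓝 (∫ x, fresnelSchwartz m hk hd φ x)) := by
    have hchirp : ∀ x : Lat m, Complex.exp (-b₀ * ‖x‖ ^ 2) * chirp (-k) d x = 1 := by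
      intro x
      rw [chirp, ← Complex.exp_add, hb₀]
      convert Complex.exp_zero
      push_cast
      ring
    have hεx : ∀ (ε : ℝ) (x : Lat m), Complex.exp (-b ε * ‖x‖ ^ 2) * chirp (-k) d x =
        Complex.exp (((-ε * ‖x‖ ^ 2 : ℝ) : ℂ)) := by
      intro ε x
      have : -b ε * ‖x‖ ^ 2 = ((-ε * ‖x‖ ^ 2 : ℝ) : ℂ) + -b₀ * ‖x‖ ^ 2 := by
        simp only [hb]
        push_cast
        ring
      rw [this, Complex.exp_add, mul_assoc, hchirp, mul_one]
    simp only [hεx]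
    refine tendsto_integral_filter_of_dominated_convergence
      (fun x => ‖fresnelSchwartz m hk hd φ x‖) ?_ ?_ (fresnelSchwartz m hk hd φ).integrable.norm ?_
    · refine Eventually.of_forall fun ε => Continuous.aestronglyMeasurable ?_
      have := (fresnelSchwartz m hk hd φ).continuous
      fun_prop
    · filter_upwards [self_mem_nhdsWithin] with ε hε
      refine Eventually.of_forall fun x => ?_
      rw [norm_mul]
      refine mul_le_of_le_one_left (norm_nonneg _) ?_
      rw [Complex.norm_exp, Complex.ofReal_re, Real.exp_le_one_iff]
      have : (0 : ℝ) < ε := hε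
      nlinarith [sq_nonneg ‖x‖]
    · refine Eventually.of_forall fun x => ?_
      have hc : Continuous fun ε : ℝ => Complex.exp (((-ε * ‖x‖ ^ 2 : ℝ) : ℂ)) *
          fresnelSchwartz m hk hd φ x := by fun_prop
      simpa using (hc.tendsto 0).mono_left nhdsWithin_le_nhds
  have hright : Tendsto (fun ε : ℝ => fresnelConst m k d * (Real.pi / b ε) ^ (m / 2 : ℂ) *
      ∫ x, φ x * gaussianField m k d (α ε) x) (𝓝[>] 0)
      (𝓝 (fresnelConst m k d * (Real.pi / b₀) ^ (m / 2 : ℂ) * ∫ x, φ x)) := by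
    refine (Tendsto.const_mul _ ?_).mul ?_
    · have hslit : (Real.pi : ℂ) / b₀ ∈ Complex.slitPlane := by
        refine Or.inr ?_
        have h0 : b 0 = b₀ := by simp [hb]
        have h1 := hb0 0
        have h2 := hbim 0
        rw [h0] at h1 h2
        rw [div_eq_mul_inv, Complex.im_ofReal_mul, Complex.inv_im, h2]
        have h3 := Complex.normSq_pos.2 h1
        have := Real.pi_pos
        rw [neg_neg]
        positivity
      have hc : ContinuousAt (fun ε : ℝ => ((Real.pi : ℂ) / b ε) ^ (m / 2 : ℂ)) 0 := by
        refine ContinuousAt.cpow (continuousAt_const.div hbc.continuousAt (hb0 0))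
          continuousAt_const ?_
        simpa [hb] using hslit
      have := hc.tendsto.mono_left (nhdsWithin_le_nhds (s := Set.Ioi 0))
      simpa [hb] using this
    · refine tendsto_integral_filter_of_dominated_convergence (fun x => ‖φ x‖) ?_ ?_
        φ.integrable.norm ?_
      · exact Eventually.of_forall fun ε =>
          (φ.continuous.mul (contDiff_gaussianField (α ε)).continuous).aestronglyMeasurable
      · filter_upwards [self_mem_nhdsWithin] with ε hε
        refine Eventually.of_forall fun x => ?_
        rw [norm_mul]
        exact mul_le_of_le_one_right (norm_nonneg _)
          (norm_gaussianField_le hk hd (hαre ε (le_of_lt hε)) x)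
      · refine Eventually.of_forall fun x => ?_
        have hc : Continuous fun ε : ℝ => φ x * gaussianField m k d (α ε) x := by
          unfold gaussianField
          fun_prop
        have := (hc.tendsto 0).mono_left (nhdsWithin_le_nhds (s := Set.Ioi 0))
        simpa [hα0, gaussianField] using this
  rw [fresnelConst_mul_cpow hk hd] at hright
  refine tendsto_nhds_unique hleft (hright.congr' ?_)
  filter_upwards [self_mem_nhdsWithin] with ε hε
  exact (integral_gaussian_mul_fresnelSchwartz hk hd (by rw [hbre]; exact hε) (hαb ε) φ).symm

/-- A probe whose propagated field is a decaying Gaussian is itself a Gaussian; in particular it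
has no zeros. -/
theorem IsGaussianBeam.ne_zero (hk : 0 < k) (hd : 0 < d) {P : Lat m → ℂ}
    (hP : IsGaussianBeam hk hd P) (x : Lat m) : P x ≠ 0 := by
  obtain ⟨hPt, p₀, α, hp₀, hαre, -, hG⟩ := hP
  set β : ℂ := α - Complex.I / 2 with hβ
  have hβre : β.re < 0 := by simpa [hβ] using hαre
  have hβ0 : β ≠ 0 := by
    intro h
    rw [h] at hβre
    simp at hβre
  have hkd : 0 < k / d := by positivity
  set b : ℂ := ((-(k / d) / 4 : ℝ) : ℂ) * β⁻¹ with hb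
  have hbre : 0 < b.re := by
    rw [hb, Complex.re_ofReal_mul, Complex.inv_re]
    have h1 := Complex.normSq_pos.2 hβ0
    exact mul_pos_of_neg_of_neg (by linarith) (div_neg_of_neg_of_pos hβre h1)
  have hb0 : b ≠ 0 := by
    intro h
    rw [h] at hbre
    simp at hbre
  have hαb : (α - Complex.I / 2) * (4 * b) = -((k / d : ℝ) : ℂ) := by
    rw [← hβ, hb]
    push_cast
    field_simp
  set g₀ : ℂ := p₀ * Complex.exp (Complex.I * ((k * d : ℝ) : ℂ)) with hg₀
  set c : ℂ := fresnelConst m k d * (Real.pi / b) ^ (m / 2 : ℂ) with hc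
  have hc0 : c ≠ 0 := by
    refine mul_ne_zero (fresnelConst_ne_zero hk hd) ?_
    have : (Real.pi : ℂ) / b ≠ 0 := div_ne_zero (by exact_mod_cast Real.pi_ne_zero) hb0
    simp [Complex.cpow_eq_zero_iff, this]
  set Q : Lat m → ℂ := fun x => g₀ / c * (Complex.exp (-b * ‖x‖ ^ 2) * chirp (-k) d x) with hQ
  have hgiven : ∀ φ : 𝓢(Lat m, ℂ), propagated hk hd P (oneDist m) φ =
      ∫ x, φ x * (g₀ * gaussianField m k d α x) := by
    intro φ
    refine hG.apply_eq_of_bounded (C := ‖g₀‖) (fun x => ?_) φ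
    rw [norm_mul]
    exact mul_le_of_le_one_right (norm_nonneg _) (norm_gaussianField_le hk hd hαre.le x)
  have hPQ : P = Q := by
    refine eq_of_forall_integral_eq hPt.1.continuous ?_ fun ψ _ => ?_
    · have : Continuous (chirp (-k) d : Lat m → ℂ) :=
        (chirp_hasTemperateGrowth (m := m) (-k) d).1.continuous
      fun_prop
    · obtain ⟨φ, rfl⟩ := fresnelSchwartz_surjective hk hd ψ
      have h1 := hgiven φ
      rw [propagated_oneDist_apply hk hd hPt] at h1
      have h2 := integral_gaussian_mul_fresnelSchwartz hk hd hbre hαb φ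
      simp only [mul_comm (fresnelSchwartz m hk hd φ _)]
      rw [h1]
      simp only [hQ, mul_assoc (g₀ / c), mul_left_comm _ g₀]
      rw [integral_const_mul, integral_const_mul, h2, ← hc, ← mul_assoc, div_mul_cancel₀ _ hc0]
  rw [hPQ]
  exact mul_ne_zero (div_ne_zero (mul_ne_zero hp₀ (Complex.exp_ne_zero _)) hc0)
    (mul_ne_zero (Complex.exp_ne_zero _) (chirp_ne_zero x))

/-- Both kinds of probes are nonvanishing and have a Gaussian background field, of exponent zero
for plane waves. -/
theorem exists_background (hk : 0 < k) (hd : 0 < d) {P : Lat m → ℂ}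
    (hP : IsPlaneWave P ∨ IsGaussianBeam hk hd P) :
    P.HasTemperateGrowth ∧ (∀ x, P x ≠ 0) ∧ ∃ g₀ α : ℂ, g₀ ≠ 0 ∧ α.re ≤ 0 ∧ α.im ≠ 1 / 2 ∧
      ∀ φ : 𝓢(Lat m, ℂ), propagated hk hd P (oneDist m) φ =
        ∫ x, φ x * (g₀ * gaussianField m k d α x) := by
  rcases hP with ⟨p₀, hp₀, rfl⟩ | hP
  · have hPt : (fun _ : Lat m => p₀).HasTemperateGrowth := by fun_prop
    refine ⟨hPt, fun _ => hp₀, p₀ * Complex.exp (Complex.I * ((k * d : ℝ) : ℂ)), 0,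
      mul_ne_zero hp₀ (Complex.exp_ne_zero _), by simp, by norm_num, fun φ => ?_⟩
    rw [propagated_oneDist_apply hk hd hPt, integral_const_mul, integral_fresnelSchwartz,
      ← mul_assoc, ← integral_const_mul]
    simp [gaussianField, mul_comm]
  · refine ⟨hP.1, hP.ne_zero hk hd, ?_⟩
    obtain ⟨-, p₀, α, hp₀, hαre, hαim, hG⟩ := hP
    refine ⟨p₀ * Complex.exp (Complex.I * ((k * d : ℝ) : ℂ)), α,
      mul_ne_zero hp₀ (Complex.exp_ne_zero _), hαre.le, hαim, fun φ => ?_⟩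
    refine hG.apply_eq_of_bounded
      (C := ‖p₀ * Complex.exp (Complex.I * ((k * d : ℝ) : ℂ))‖) (fun x => ?_) φ
    rw [norm_mul]
    exact mul_le_of_le_one_right (norm_nonneg _) (norm_gaussianField_le hk hd hαre.le x)

end Background

/-! ### Recovery of the object from intensities -/

section Recovery

open Filter Topology ComplexConjugate

variable {m : ℕ} {k d : ℝ}

/-- Interference identity: with reference wave `w = g exp (α q)` and scattered wave
`u = c exp (i q / 2) F`, the combination `|w + u|² - t |u|²` is a sum of terms with the phases
`γ q`, `conj γ q` and `0`, where `γ = conj α + i / 2`. -/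
theorem interference_identity (g α c F : ℂ) (q t : ℝ) :
    (((‖g * Complex.exp (α * q) + c * (Complex.exp (Complex.I / 2 * q) * F)‖ ^ 2 -
        t * ‖c * (Complex.exp (Complex.I / 2 * q) * F)‖ ^ 2 : ℝ)) : ℂ) =
      g * conj g * (Complex.exp (α * q) * Complex.exp (conj α * q)) +
        conj g * c * Complex.exp ((conj α + Complex.I / 2) * q) * F +
        g * conj c * Complex.exp (conj (conj α + Complex.I / 2) * q) * conj F +
        (1 - t) * (c * conj c) * (F * conj F) := by
  have h1 : Complex.exp (Complex.I / 2 * q) * conj (Complex.exp (Complex.I / 2 * q)) = 1 := by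
    rw [← Complex.exp_conj, ← Complex.exp_add]
    convert Complex.exp_zero
    simp [map_ofNat]
    ring
  have h2 : Complex.exp ((conj α + Complex.I / 2) * q) =
      conj (Complex.exp (α * q)) * Complex.exp (Complex.I / 2 * q) := by
    rw [← Complex.exp_conj, ← Complex.exp_add]
    congr 1
    simp
    ring
  have h3 : Complex.exp (conj (conj α + Complex.I / 2) * q) =
      Complex.exp (α * q) * conj (Complex.exp (Complex.I / 2 * q)) := by
    rw [← Complex.exp_conj, ← Complex.exp_add]
    congr 1
    simp
    ring
  have h4 : Complex.exp (conj α * q) = conj (Complex.exp (α * q)) := by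
    rw [← Complex.exp_conj]
    simp
  push_cast
  rw [← Complex.mul_conj', ← Complex.mul_conj', h2, h3, h4]
  simp only [map_add, map_mul]
  linear_combination (c * F * conj c * conj F * (1 - t)) * h1

theorem chirp_eq_exp (x : Lat m) :
    chirp k d x = Complex.exp (Complex.I / 2 * ((k / d * ‖x‖ ^ 2 : ℝ) : ℂ)) := by
  rw [chirp]
  congr 1
  push_cast
  ring

/-- On an open set, the quantity `|w + u|² - t |u|²` with a Gaussian reference wave `w` and a
scattered wave `u` that is a chirp times a Paley-Wiener function determines the latter. -/
theorem paleyWiener_eq_of_eqOn (hm : 1 ≤ m) (hk : 0 < k) (hd : 0 < d) {g α c : ℂ} (hg : g ≠ 0)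
    (hα : α.im ≠ 1 / 2) (hc : c ≠ 0) (t : ℝ) {f f' : Lat m → ℂ} (hf : IsPaleyWiener f)
    (hf' : IsPaleyWiener f') {U : Set (Lat m)} (hU : IsOpen U) (hUn : U.Nonempty)
    (h : ∀ x ∈ U,
      ‖g * gaussianField m k d α x + c * (chirp k d x * f x)‖ ^ 2 -
        t * ‖c * (chirp k d x * f x)‖ ^ 2 =
      ‖g * gaussianField m k d α x + c * (chirp k d x * f' x)‖ ^ 2 -
        t * ‖c * (chirp k d x * f' x)‖ ^ 2) : f = f' := by
  obtain ⟨x₀, hx₀⟩ := hUn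
  have : Nonempty (Fin m) := ⟨⟨0, hm⟩⟩
  funext y
  -- The direction has to be nonzero even for `y = x₀`, which is where `1 ≤ m` enters.
  obtain ⟨v, s₁, hv, hy⟩ : ∃ (v : Lat m) (s : ℝ), v ≠ 0 ∧ y = x₀ + s • v := by
    by_cases hxy : y = x₀
    · obtain ⟨v, hv⟩ := exists_ne (0 : Lat m)
      exact ⟨v, 0, hv, by simp [hxy]⟩
    · exact ⟨y - x₀, 1, sub_ne_zero.2 hxy, by simp⟩
  obtain ⟨F, hF, hFs⟩ := hf.line x₀ v
  obtain ⟨F', hF', hFs'⟩ := hf'.line x₀ v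
  set q₀ : ℝ := k / d * ‖x₀‖ ^ 2 with hq₀
  set q₁ : ℝ := k / d * (2 * inner ℝ x₀ v) with hq₁
  set q₂ : ℝ := k / d * ‖v‖ ^ 2 with hq₂
  have hq₂0 : 0 < q₂ := by
    have := norm_pos_iff.2 hv
    positivity
  have hq : ∀ s : ℝ, k / d * ‖x₀ + s • v‖ ^ 2 = q₀ + q₁ * s + q₂ * s ^ 2 := by
    intro s
    rw [norm_add_sq_real, real_inner_smul_right, norm_smul, mul_pow, Real.norm_eq_abs, sq_abs,
      hq₀, hq₁, hq₂]
    ring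
  set γ : ℂ := conj α + Complex.I / 2 with hγ
  have hγim : γ.im ≠ 0 := by
    intro h0
    have : γ.im = -α.im + 1 / 2 := by simp [hγ]
    rw [this] at h0
    exact hα (by linarith)
  have hA : IsExpType fun z => F z - F' z := hF.sub hF'
  have hB : IsExpType fun z => conj (F (conj z)) - conj (F' (conj z)) :=
    hF.conj_conj.sub hF'.conj_conj
  have hC : IsExpType fun z => (1 - t) * (c * conj c) *
      (F z * conj (F (conj z)) - F' z * conj (F' (conj z))) :=
    (IsExpType.const _).mul ((hF.mul hF.conj_conj).sub (hF'.mul hF'.conj_conj))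
  have hzero : ∀ z : ℂ,
      conj g * c * Complex.exp (γ * (q₀ + q₁ * z + q₂ * z ^ 2)) * (F z - F' z) +
        g * conj c * Complex.exp (conj γ * (q₀ + q₁ * z + q₂ * z ^ 2)) *
          (conj (F (conj z)) - conj (F' (conj z))) +
        (1 - t) * (c * conj c) * (F z * conj (F (conj z)) - F' z * conj (F' (conj z))) = 0 := by
    refine eq_zero_of_eventually_real ?_ 0 ?_
    · have e1 := hA.differentiable
      have e2 := hB.differentiable
      have e3 := hC.differentiable
      have e4 : ∀ δ : ℂ, Differentiable ℂ fun z : ℂ =>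
          Complex.exp (δ * (q₀ + q₁ * z + q₂ * z ^ 2)) := fun δ => by fun_prop
      exact ((((e4 γ).const_mul _).mul e1).add (((e4 (conj γ)).const_mul _).mul e2)).add e3
    · have hcont : Continuous fun s : ℝ => x₀ + s • v := by fun_prop
      have hmem : ∀ᶠ s : ℝ in 𝓝 0, x₀ + s • v ∈ U :=
        hcont.continuousAt.eventually_mem (hU.mem_nhds (by simpa using hx₀))
      filter_upwards [hmem] with s hs
      have hs' := congrArg (fun r : ℝ => (r : ℂ)) (h _ hs)
      simp only [gaussianField, chirp_eq_exp] at hs'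
      rw [interference_identity, interference_identity, ← hFs, ← hFs', hq] at hs'
      push_cast at hs'
      rw [Complex.conj_ofReal]
      linear_combination hs'
  have hfin := hA.eq_zero_of_gaussian_combination hB hC
    (mul_ne_zero ((map_ne_zero _).2 hg) hc) hγim hq₂0 hzero s₁
  rw [hy, ← hFs, ← hFs']
  exact sub_eq_zero.1 hfin

/-- The field behind an object is the sum of a Gaussian background and a scattered wave that is a
chirp times a Paley-Wiener function. -/
theorem exists_fields (hk : 0 < k) (hd : 0 < d) {P : Lat m → ℂ} (hP : P.HasTemperateGrowth)
    {g α : ℂ} (hα : α.re ≤ 0)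
    (hbg : ∀ φ : 𝓢(Lat m, ℂ), propagated hk hd P (oneDist m) φ =
      ∫ x, φ x * (g * gaussianField m k d α x))
    {O : 𝓢'(Lat m, ℂ)} (hO : IsObject O) :
    ∃ f : Lat m → ℂ, IsPaleyWiener f ∧
      (∀ φ : 𝓢(Lat m, ℂ), propagated hk hd P (O - oneDist m) φ =
        ∫ x, φ x * (fresnelConst m k d * (chirp k d x * f x))) ∧
      IsGivenBy (propagated hk hd P O)
        (fun x => g * gaussianField m k d α x + fresnelConst m k d * (chirp k d x * f x)) ∧
      IsGivenBy (propagated hk hd P (O - oneDist m))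
        (fun x => fresnelConst m k d * (chirp k d x * f x)) := by
  obtain ⟨f, hf, hfT⟩ := exists_propagated_eq hk hd hP hO
  have hch := chirp_hasTemperateGrowth (m := m) k d
  have hsm : ContDiff ℝ ∞ fun x => fresnelConst m k d * (chirp k d x * f x) :=
    contDiff_const.mul (hch.1.mul hf.contDiff)
  refine ⟨f, hf, hfT, ⟨(contDiff_const.mul (contDiff_gaussianField α)).add hsm, fun φ _ => ?_⟩,
    hsm, fun φ _ => hfT φ⟩
  have hsplit : propagated hk hd P O φ =
      propagated hk hd P (oneDist m) φ + propagated hk hd P (O - oneDist m) φ := by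
    have h1 : O = oneDist m + (O - oneDist m) := by abel
    conv_lhs => rw [h1, propagated_add]
    rfl
  have hi₁ : Integrable fun x => φ x * (g * gaussianField m k d α x) := by
    refine ((integrable_mul_gaussianField hk hd hα φ).const_mul g).congr
      (Eventually.of_forall fun x => ?_)
    ring
  have hi₂ : Integrable fun x => φ x * (fresnelConst m k d * (chirp k d x * f x)) := by
    refine ((hf.integrable_mul (SchwartzMap.smulLeftCLM ℂ (chirp k d) φ)).const_mul
      (fresnelConst m k d)).congr (Eventually.of_forall fun x => ?_)
    simp only [SchwartzMap.smulLeftCLM_apply_apply hch, smul_eq_mul]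
    ring
  rw [hsplit, hbg, hfT, ← integral_add hi₁ hi₂]
  simp only [mul_add]

end Recovery

end PhaseContrast

end

/-- Uniqueness of near-field phase contrast imaging: the data are well defined smooth functions,
and each of `I_d` and its linearization, restricted to a nonempty open set, determines `O`. -/
theorem corollary2p1 (m : ℕ) (hm : 1 ≤ m) (k d : ℝ) (hk : 0 < k) (hd : 0 < d)
    (P : PhaseContrast.Lat m → ℂ)
    (hP : PhaseContrast.IsPlaneWave P ∨ PhaseContrast.IsGaussianBeam hk hd P) :
    (∀ O : 𝓢'(PhaseContrast.Lat m, ℂ), PhaseContrast.IsObject O →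
      (∃ ψ, PhaseContrast.IsGivenBy (PhaseContrast.propagated hk hd P O) ψ) ∧
      (∃ χ, PhaseContrast.IsGivenBy
        (PhaseContrast.propagated hk hd P (O - PhaseContrast.oneDist m)) χ)) ∧
    ∀ U : Set (PhaseContrast.Lat m), IsOpen U → U.Nonempty →
      ∀ O O' : 𝓢'(PhaseContrast.Lat m, ℂ),
        PhaseContrast.IsObject O → PhaseContrast.IsObject O' →
        (Set.EqOn (PhaseContrast.intensity hk hd P O)
          (PhaseContrast.intensity hk hd P O') U → O = O') ∧
        (Set.EqOn (PhaseContrast.linIntensity hk hd P O)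
          (PhaseContrast.linIntensity hk hd P O') U → O = O') := by
  obtain ⟨hPt, hP0, g, α, hg, hαre, hαim, hbg⟩ := PhaseContrast.exists_background hk hd hP
  refine ⟨fun O hO => ?_, fun U hU hUn O O' hO hO' => ?_⟩
  · obtain ⟨f, -, -, h₁, h₂⟩ := PhaseContrast.exists_fields hk hd hPt hαre hbg hO
    exact ⟨⟨_, h₁⟩, ⟨_, h₂⟩⟩
  · obtain ⟨f, hf, hfT, h₁, h₂⟩ := PhaseContrast.exists_fields hk hd hPt hαre hbg hO
    obtain ⟨f', hf', hfT', h₁', h₂'⟩ := PhaseContrast.exists_fields hk hd hPt hαre hbg hO'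
    have hconst := PhaseContrast.fresnelConst_ne_zero (m := m) hk hd
    have hff : f = f' → O = O' := by
      rintro rfl
      exact sub_left_injective (PhaseContrast.eq_of_propagated_eq hk hd hPt hP0 hO hO' fun φ => by
        rw [hfT, hfT'])
    refine ⟨fun h => hff ?_, fun h => hff ?_⟩
    · refine PhaseContrast.paleyWiener_eq_of_eqOn hm hk hd hg hαim hconst 0 hf hf' hU hUn
        fun x hx => ?_
      have := h hx
      simp only [PhaseContrast.intensity, h₁.toFunction_eq, h₁'.toFunction_eq] at this
      rw [this, zero_mul, zero_mul]
    · refine PhaseContrast.paleyWiener_eq_of_eqOn hm hk hd hg hαim hconst 1 hf hf' hU hUn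
        fun x hx => ?_
      have := h hx
      simp only [PhaseContrast.linIntensity, PhaseContrast.intensity, h₁.toFunction_eq,
        h₁'.toFunction_eq, h₂.toFunction_eq, h₂'.toFunction_eq] at this
      rw [one_mul, one_mul, this]
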